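/- Let $(\Lambda,\Lambda^*,R,R^*)$ be a reduced semisimple root datum: $\Lambda\simeq\mathbb Z^r$, $\Lambda^*$ is its dual under the pairing $\langle\,,\rangle$, $R\subset\Lambda$ is a finite reduced root system with simple roots $\alpha_1,\dots,\alpha_r$ ($r=\operatorname{rank}\Lambda$), $R^*\subset\Lambda^*$ is the set of coroots $\alpha^*$. Let $W$ be the Weyl group, generated by the simple reflections $s_i(\lambda)=\lambda-\langle\alpha_i^*,\lambda\rangle\alpha_i$, with length function $\ell$ and longest element $w_0$. Let $Q(\mathbb Z[\Lambda])$ be the fraction field of the group algebra of $\Lambda$ (with $\mathbb Z$-basis $e^\lambda$, $\lambda\in\Lambda$), on which $W$ acts by $w(e^\lambda)=e^{w\lambda}$, and let $Q_{t_1,t_2}(\Lambda)=\mathbb Z[t_1,t_2]\otimes Q(\mathbb Z[\Lambda])$, where $W$ fixes $t_1,t_2$. Let $H$ be the $Q_{t_1,t_2}(\Lambda)$-algebra with generators $h_1,\dots,h_r$, quadratic relations $(h_i-t_1)(h_i-t_2)=0$ and braid relations $h_ih_jh_i\cdots=h_jh_ih_j\cdots$ ($m_{i,j}$ factors on each side,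 $m_{i,j}$ the order of $s_is_j$, $i\ne j$). For a reduced expression $w=s_{i_1}\cdots s_{i_\ell}$ put $h_w=h_{i_1}\cdots h_{i_\ell}$; this does not depend on the reduced expression, and $(h_w)_{w\in W}$ is a $Q_{t_1,t_2}(\Lambda)$-basis of $H$. Put $E(\lambda)=e^{-\lambda}-1$. The Yang–Baxter elements $Y_w\in H$ are well defined by $$Y_e=1,\qquad Y_{ws_i}=Y_w\Bigl(h_i+\frac{t_1+t_2}{E(w\alpha_i)}\Bigr)\quad\text{if }\ell(ws_i)>\ell(w).$$ For $g=\sum_w c_wh_w\in H$ put $g^\vee=\sum_w c_wh_{w^{-1}}$ and, for $u\in W$, $u(g)=\sum_w u(c_w)h_w$ (the action on the coefficients only). For $f,g\in H$ let $(f,g)^H$ be the coefficient of $h_{w_0}$ in $fg^\vee$, with respect to the basis $(h_w)$. Then, for all $v,w\in W$, $$\bigl(Y_v,\;w_0(Y_{w_0w})\bigr)^H=\delta_{v,w}.$$ -/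

import Mathlib

namespace YangBaxter

noncomputable section

/-! ### Coefficients -/

section Coefficients

variable (M : Type*) [AddCommGroup M] [Module.Free ℤ M]

/-- A free abelian group has unique sums, so that `ℤ[M]` is a domain. -/
instance twoUniqueSums_of_free : TwoUniqueSums M :=
  TwoUniqueSums.of_injective_addHom
    ((Module.Free.chooseBasis ℤ M).repr : M →+ Module.Free.ChooseBasisIndex ℤ M →₀ ℤ).toAddHom
    (Module.Free.chooseBasis ℤ M).repr.injective inferInstance

/-- The group algebra `ℤ[Λ]` of a lattice `Λ` and its quotient field `Q(ℤ[Λ])`. -/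
abbrev GroupAlgFrac : Type _ := FractionRing (AddMonoidAlgebra ℤ M)

/-- `Q_{t₁,t₂}(Λ) = ℤ[t₁,t₂] ⊗ Q(ℤ[Λ])`, i.e. the polynomial ring in two variables `t₁, t₂` over
the quotient field of `ℤ[Λ]`. -/
abbrev Coeff : Type _ := MvPolynomial (Fin 2) (GroupAlgFrac M)

/-- The parameter `t₁`. -/
def t₁ : Coeff M := MvPolynomial.X 0

/-- The parameter `t₂`. -/
def t₂ : Coeff M := MvPolynomial.X 1

variable {M}

/-- `e^μ`, as an element of the quotient field of `ℤ[Λ]`. -/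
def expo (μ : M) : GroupAlgFrac M :=
  algebraMap (AddMonoidAlgebra ℤ M) (GroupAlgFrac M) (AddMonoidAlgebra.single μ 1)

/-- `E(μ) = e^{-μ} - 1`. -/
def E (μ : M) : GroupAlgFrac M := expo (-μ) - 1

/-- The fraction `(t₁ + t₂) / E(μ)` (meaningful for `μ ≠ 0`). -/
def ybCoeff (μ : M) : Coeff M := (t₁ M + t₂ M) * MvPolynomial.C (E μ)⁻¹

/-- The ring automorphism of `Q(ℤ[Λ])` induced by an automorphism `g` of `Λ` through
`e^μ ↦ e^{g μ}`. -/
def fracAut (g : M ≃+ M) : GroupAlgFrac M ≃+* GroupAlgFrac M :=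
  IsFractionRing.ringEquivOfRingEquiv
    (AddMonoidAlgebra.domCongr ℤ ℤ g : AddMonoidAlgebra ℤ M ≃ₐ[ℤ] AddMonoidAlgebra ℤ M).toRingEquiv

/-- The action of an automorphism of `Λ` on `Q_{t₁,t₂}(Λ)`; it fixes `t₁` and `t₂`. -/
def coeffAut (g : M ≃+ M) : Coeff M →+* Coeff M :=
  MvPolynomial.map (fracAut g : GroupAlgFrac M →+* GroupAlgFrac M)

end Coefficients

/-! ### The Weyl group: simple reflections, words, length -/

section Weyl

variable {ι M N : Type*} [AddCommGroup M] [AddCommGroup N] {P : RootPairing ι ℤ M N}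
  (b : P.Base)

/-- The simple reflection `s_i`, as an element of the Weyl group. -/
def simple (i : b.support) : P.weylGroup := RootPairing.weylGroup.ofIdx P i

/-- The product `s_{i₁} ⋯ s_{i_ℓ}` of a word `[i₁, …, i_ℓ]`. -/
def wordProd (l : List b.support) : P.weylGroup := (l.map (simple b)).prod

/-- A word is reduced if no shorter word has the same product. -/
def IsReducedWord (l : List b.support) : Prop :=
  ∀ l' : List b.support, wordProd b l' = wordProd b l → l.length ≤ l'.length

lemma reflection_reflectionPerm_eq (i j : ι) :
    RootPairing.Equiv.reflection P (P.reflectionPerm j i) =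
      RootPairing.Equiv.reflection P j * RootPairing.Equiv.reflection P i *
        RootPairing.Equiv.reflection P j := by
  apply RootPairing.Equiv.weightHom_injective P
  ext x
  rw [map_mul, map_mul]
  exact LinearEquiv.congr_fun (P.reflection_reflectionPerm (i := i) (j := j)) x

variable [Finite ι] [P.IsReduced]

/-- The simple reflections generate the Weyl group. -/
lemma exists_wordProd_eq (w : P.weylGroup) : ∃ l : List b.support, wordProd b l = w := by
  let G : Submonoid P.weylGroup := Submonoid.closure (Set.range (simple b))
  suffices h : w ∈ G by
    obtain ⟨l, hl, rfl⟩ := Submonoid.exists_list_of_mem_closure h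
    choose f hf using hl
    refine ⟨l.attach.map fun x => f x.1 x.2, ?_⟩
    simp only [wordProd, List.map_map, Function.comp_def, hf, List.attach_map_subtype_val]
  have hr (i : ι) : RootPairing.weylGroup.ofIdx P i ∈ G := by
    have key (i j : ι) : RootPairing.weylGroup.ofIdx P (P.reflectionPerm j i) =
        RootPairing.weylGroup.ofIdx P j * RootPairing.weylGroup.ofIdx P i *
          RootPairing.weylGroup.ofIdx P j :=
      Subtype.ext (reflection_reflectionPerm_eq i j)
    induction i using b.induction_reflect with
    | h₀ i hi => rw [key]; exact mul_mem (mul_mem hi hi) hi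
    | h₁ i hi => exact Submonoid.subset_closure ⟨⟨i, hi⟩, rfl⟩
    | h₂ i j hi hj =>
      have hj' : RootPairing.weylGroup.ofIdx P j ∈ G := Submonoid.subset_closure ⟨⟨j, hj⟩, rfl⟩
      rw [key]; exact mul_mem (mul_mem hj' hi) hj'
  obtain ⟨w, hw⟩ := w
  induction hw using RootPairing.weylGroup.induction with
  | mem i => exact hr i
  | one => exact one_mem G
  | mul x y hx hy hx' hy' => exact mul_mem hx' hy'

lemma exists_reducedWord (w : P.weylGroup) :
    ∃ l : List b.support, wordProd b l = w ∧ IsReducedWord b l := by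
  classical
  have h : ∃ n, ∃ l : List b.support, wordProd b l = w ∧ l.length = n := by
    obtain ⟨l, hl⟩ := exists_wordProd_eq b w
    exact ⟨_, l, hl, rfl⟩
  obtain ⟨l, hl, hn⟩ := Nat.find_spec h
  exact ⟨l, hl, fun l' hl' => hn ▸ Nat.find_min' h ⟨l', hl'.trans hl, rfl⟩⟩

/-- A reduced expression of `w`. -/
def reducedWord (w : P.weylGroup) : List b.support := (exists_reducedWord b w).choose

/-- The length `ℓ(w)`. -/
def length (w : P.weylGroup) : ℕ := (reducedWord b w).length

/-- `w₀` is a longest element of the Weyl group. -/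
def IsLongest (w₀ : P.weylGroup) : Prop := ∀ w, length b w ≤ length b w₀

end Weyl

/-! ### The Hecke algebra -/

section Hecke

variable {ι M N : Type*} [AddCommGroup M] [AddCommGroup N] {P : RootPairing ι ℤ M N}
  (b : P.Base)

/-- The alternating product `x y x ⋯` with `n` factors. -/
def altProd {A : Type*} [Monoid A] : ℕ → A → A → A
  | 0, _, _ => 1
  | n + 1, x, y => x * altProd n y x

/-- The defining relations of the Hecke algebra with parameters `a₁, a₂`:
`(h_i - a₁) (h_i - a₂) = 0`, and the braid relations with `m_{i,j}` the order of `s_i s_j`. -/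
inductive HeckeRel {R : Type*} [CommRing R] (a₁ a₂ : R) :
    FreeAlgebra R b.support → FreeAlgebra R b.support → Prop
  | quadratic (i : b.support) :
      HeckeRel a₁ a₂
        ((FreeAlgebra.ι R i - algebraMap R _ a₁) * (FreeAlgebra.ι R i - algebraMap R _ a₂)) 0
  | braid (i j : b.support) (hij : i ≠ j) :
      HeckeRel a₁ a₂
        (altProd (orderOf (simple b i * simple b j)) (FreeAlgebra.ι R i) (FreeAlgebra.ι R j))
        (altProd (orderOf (simple b i * simple b j)) (FreeAlgebra.ι R j) (FreeAlgebra.ι R i))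

variable [Module.Free ℤ M]

/-- The generic Hecke algebra with coefficients extended to `Q_{t₁,t₂}(Λ)`. -/
abbrev Hecke : Type _ := RingQuot (HeckeRel b (t₁ M) (t₂ M))

/-- The generator `h_i`. -/
def gen (i : b.support) : Hecke b :=
  RingQuot.mkAlgHom (Coeff M) (HeckeRel b (t₁ M) (t₂ M)) (FreeAlgebra.ι (Coeff M) i)

/-- The product `∏_j (h_{i_j} + (t₁ + t₂) / (u s_{i₁} ⋯ s_{i_{j-1}} E(α_{i_j})))` over a word
`[i₁, …, i_ℓ]`, taken from left to right; here `u E(μ) = E(u μ)` for `u` in the Weyl group. -/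
def ybProd : P.weylGroup → List b.support → Hecke b
  | _, [] => 1
  | u, i :: l => (gen b i + algebraMap (Coeff M) (Hecke b) (ybCoeff (u • P.root i))) *
      ybProd (u * simple b i) l

variable [Finite ι] [P.IsReduced]

/-- The element `h_w = h_{i₁} ⋯ h_{i_ℓ}`, for a reduced expression of `w`. -/
def heckeElt (w : P.weylGroup) : Hecke b := ((reducedWord b w).map (gen b)).prod

/-- The Yang–Baxter element `Y_w`, computed from a reduced expression of `w`. -/
def ybElt (w : P.weylGroup) : Hecke b := ybProd b 1 (reducedWord b w)

end Hecke

/-! ### Operations on the Hecke algebra relative to the basis `(h_w)` -/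

section Form

variable {ι M N : Type*} [AddCommGroup M] [AddCommGroup N] {P : RootPairing ι ℤ M N}
  {b : P.Base} [Module.Free ℤ M] (B : Module.Basis P.weylGroup (Coeff M) (Hecke b))

/-- `g^∨ = ∑ c_w h_{w⁻¹}` for `g = ∑ c_w h_w`, where `(h_w)` is the basis `B`. -/
def vee (g : Hecke b) : Hecke b := (B.repr g).sum fun w c => c • B w⁻¹

/-- The action of `u ∈ W` on the coefficients only: `∑ c_w h_w ↦ ∑ u(c_w) h_w`, where `(h_w)` is
the basis `B`. -/
def coeffAct (u : P.weylGroup) (g : Hecke b) : Hecke b :=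
  (B.repr g).sum fun w c => coeffAut (DistribMulAction.toAddEquiv M u) c • B w

/-- `(f, g)^H`, the coefficient of `h_{w₀}` in `f g^∨`, where `(h_w)` is the basis `B`. -/
def form (w₀ : P.weylGroup) (f g : Hecke b) : Coeff M := B.repr (f * vee B g) w₀

end Form

end

end YangBaxter

namespace YangBaxter

/-! ### Combinatorics of the Weyl group -/

section WeylCombinatorics

open RootPairing

variable {ι M N : Type*} [AddCommGroup M] [AddCommGroup N] {P : RootPairing ι ℤ M N}
  (b : P.Base)

/-! Put `G_w = w₀(Y_{w₀w})`. The orthogonality `(Y_v, G_w) = δ_{v,w}` goes by induction on `ℓ(v)`,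
moving one factor of `Y_v` to the other side.

The form satisfies `(f(h_i + a), g) = (f, g(h_i + a))` (`form_mul_gen_add`), because `∨` reverses
products with a generator (`vee_mul_gen`). Right multiplication of `G_w` by `h_i + (t₁+t₂)/E(wα_i)`
gives `G_{ws_i}` when `wα_i` is negative, since `w₀` turns descents into ascents
(`coeffAct_ybElt_mul_simple`). It gives a multiple of `G_{ws_i}` when `wα_i` is positive, since the
factors for `μ` and `-μ` multiply to a scalar (`exists_ybElt_mul_eq_smul`). If `vs_i < v`, the
factor split off from `Y_v` has its coefficient at `vs_iα_i` instead of `wα_i`. The error is a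
multiple of `(Y_{vs_i}, G_w) = δ_{vs_i,w}`, and the multiplier vanishes when `w = vs_i`. Thus `(Y_v,
G_w)` is a multiple of `(Y_{vs_i}, G_{ws_i})`, with multiplier 1 in the case that contains `w = v`.
For `v = 1` the form reads off the top coefficient of `G_w`, which is known because `Y_w` is `h_w`
plus shorter terms (`repr_ybElt_of_isLongest`).

The remaining work is foundational. Descents are read from signs of roots through the exchange
property, which leads to `matsumoto`. The `h_w` are independent because left and right operators on
the free module over `W` commute (`commute_leftOp_rightOp`). `Y_w` does not depend on the reduced
word because the Yang–Baxter relation holds in each rank-two type (`ybProd_altWord`). -/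

lemma root_smul (w : P.weylGroup) (k : ι) : P.root (w • k) = w • P.root k :=
  (weylGroup_apply_root P w k).symm

lemma simple_smul_index (i : b.support) (k : ι) :
    simple b i • k = P.reflectionPerm i k := rfl

lemma ofIdx_mul_self (k : ι) : weylGroup.ofIdx P k * weylGroup.ofIdx P k = 1 := by
  apply Subtype.ext
  change Equiv.reflection P k * Equiv.reflection P k = 1
  rw [mul_eq_one_iff_inv_eq, Equiv.reflection_inv P k]

@[simp] lemma simple_mul_self (i : b.support) : simple b i * simple b i = 1 :=
  ofIdx_mul_self _

@[simp] lemma simple_mul_cancel_left (i : b.support) (w : P.weylGroup) :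
    simple b i * (simple b i * w) = w := by
  rw [← mul_assoc, simple_mul_self, one_mul]

@[simp] lemma mul_simple_cancel_right (w : P.weylGroup) (i : b.support) :
    w * simple b i * simple b i = w := by
  rw [mul_assoc, simple_mul_self, mul_one]

@[simp] lemma simple_inv (i : b.support) : (simple b i)⁻¹ = simple b i :=
  inv_eq_of_mul_eq_one_left (simple_mul_self b i)

@[simp] lemma wordProd_nil : wordProd b [] = 1 := rfl

@[simp] lemma wordProd_cons (i : b.support) (l : List b.support) :
    wordProd b (i :: l) = simple b i * wordProd b l := by simp [wordProd]

@[simp] lemma wordProd_append (l l' : List b.support) :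
    wordProd b (l ++ l') = wordProd b l * wordProd b l' := by simp [wordProd]

lemma wordProd_reverse (l : List b.support) : wordProd b l.reverse = (wordProd b l)⁻¹ := by
  induction l with
  | nil => simp
  | cons i l ih => simp [ih]

lemma ofIdx_simple_smul (i : b.support) (k : ι) :
    weylGroup.ofIdx P (simple b i • k) = simple b i * weylGroup.ofIdx P k * simple b i :=
  Subtype.ext (reflection_reflectionPerm_eq k (i : ι))

lemma isPos_reflectionPerm_self_iff (k : ι) : b.IsPos (P.reflectionPerm k k) ↔ ¬ b.IsPos k :=
  RootPairing.Base.IsPos.neg_iff_not (b := b) k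

lemma isPos_simple (i : b.support) : b.IsPos i := RootPairing.Base.isPos_of_mem_support i.2

lemma isPos_smul_reflectionPerm_self_iff (w : P.weylGroup) (k : ι) :
    b.IsPos (w • P.reflectionPerm k k) ↔ ¬ b.IsPos (w • k) := by
  rw [← isPos_reflectionPerm_self_iff]
  suffices h : w • P.reflectionPerm k k = P.reflectionPerm (w • k) (w • k) by rw [h]
  apply P.root.injective
  rw [root_smul, root_reflectionPerm, root_reflectionPerm, reflection_apply_self,
    reflection_apply_self, root_smul, smul_neg]

lemma not_isPos_simple_smul_self (i : b.support) : ¬ b.IsPos (simple b i • (i : ι)) := by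
  rw [simple_smul_index, isPos_reflectionPerm_self_iff, not_not]
  exact isPos_simple b i

lemma isPos_mul_simple_smul_iff (w : P.weylGroup) (i : b.support) :
    b.IsPos ((w * simple b i) • (i : ι)) ↔ ¬ b.IsPos (w • (i : ι)) := by
  rw [mul_smul, simple_smul_index, isPos_smul_reflectionPerm_self_iff]

variable [Finite ι] [P.IsReduced]

variable {b} in
lemma isPos_simple_smul {i : b.support} {k : ι} (hk : b.IsPos k) (hki : k ≠ i) :
    b.IsPos (simple b i • k) :=
  hk.reflectionPerm i.2 hki

/-- The strong exchange property. -/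
lemma exists_eraseIdx_of_not_isPos (l : List b.support) (k : ι) (hk : b.IsPos k)
    (h : ¬ b.IsPos ((wordProd b l)⁻¹ • k)) :
    ∃ p < l.length, weylGroup.ofIdx P k * wordProd b l = wordProd b (l.eraseIdx p) := by
  induction l generalizing k with
  | nil => exact absurd hk (by simpa using h)
  | cons j l ih =>
    by_cases hkj : k = j
    · subst hkj
      refine ⟨0, by simp, ?_⟩
      rw [wordProd_cons]
      exact simple_mul_cancel_left b j (wordProd b l)
    -- `s_j` keeps every positive root other than `α_j` positive, so the tail can be treated with
    -- the root `s_j α_k`; conjugating by `s_j` returns to the reflection in `α_k`.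
    · obtain ⟨p, hp, hp'⟩ := ih (simple b j • k) (isPos_simple_smul hk hkj)
        (by simpa [mul_smul] using h)
      refine ⟨p + 1, by simpa using hp, ?_⟩
      rw [ofIdx_simple_smul, mul_assoc, mul_assoc] at hp'
      rw [List.eraseIdx_cons_succ, wordProd_cons, wordProd_cons, ← hp', simple_mul_cancel_left]

lemma wordProd_reducedWord (w : P.weylGroup) : wordProd b (reducedWord b w) = w :=
  (exists_reducedWord b w).choose_spec.1

lemma isReducedWord_reducedWord (w : P.weylGroup) : IsReducedWord b (reducedWord b w) :=
  (exists_reducedWord b w).choose_spec.2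

lemma length_wordProd_le (l : List b.support) : length b (wordProd b l) ≤ l.length :=
  isReducedWord_reducedWord b (wordProd b l) l (wordProd_reducedWord b _).symm

lemma isReducedWord_iff (l : List b.support) :
    IsReducedWord b l ↔ length b (wordProd b l) = l.length := by
  refine ⟨fun h ↦ (length_wordProd_le b l).antisymm (h _ (wordProd_reducedWord b _)),
    fun h l' hl' ↦ ?_⟩
  rw [← h, ← hl']
  exact length_wordProd_le b l'

@[simp] lemma length_one : length b 1 = 0 := by
  simpa using length_wordProd_le b []

@[simp] lemma length_inv (w : P.weylGroup) : length b w⁻¹ = length b w := by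
  have key (w : P.weylGroup) : length b w⁻¹ ≤ length b w := by
    rw [← wordProd_reducedWord b w, ← wordProd_reverse, wordProd_reducedWord b w]
    exact (length_wordProd_le b _).trans (by simp [length])
  exact (key w).antisymm (by simpa using key w⁻¹)

lemma length_mul_le (v w : P.weylGroup) : length b (v * w) ≤ length b v + length b w := by
  rw [← wordProd_reducedWord b v, ← wordProd_reducedWord b w, ← wordProd_append,
    wordProd_reducedWord b v, wordProd_reducedWord b w]
  exact (length_wordProd_le b _).trans (by simp [length])

lemma length_simple_mul_le (i : b.support) (w : P.weylGroup) :
    length b (simple b i * w) ≤ length b w + 1 := by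
  have h := length_wordProd_le b (i :: reducedWord b w)
  rwa [wordProd_cons, wordProd_reducedWord] at h

lemma length_le_simple_mul (i : b.support) (w : P.weylGroup) :
    length b w ≤ length b (simple b i * w) + 1 := by
  simpa using length_simple_mul_le b i (simple b i * w)

/-- Exchange trades the prefix `s_i` for the deletion of a letter in a reduced word of `w`. From
here on, descents are detected by signs of roots. -/
lemma length_simple_mul_lt_of_not_isPos (i : b.support) (w : P.weylGroup)
    (h : ¬ b.IsPos (w⁻¹ • (i : ι))) : length b (simple b i * w) < length b w := by
  obtain ⟨p, hp, hp'⟩ := exists_eraseIdx_of_not_isPos b (reducedWord b w) i (isPos_simple b i)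
    (by rwa [wordProd_reducedWord])
  rw [wordProd_reducedWord] at hp'
  change simple b i * w = _ at hp'
  rw [hp']
  refine (length_wordProd_le b _).trans_lt ?_
  rw [List.length_eraseIdx_of_lt hp, length]
  omega

lemma length_simple_mul_lt_iff (i : b.support) (w : P.weylGroup) :
    length b (simple b i * w) < length b w ↔ ¬ b.IsPos (w⁻¹ • (i : ι)) := by
  refine ⟨fun h hp ↦ ?_, length_simple_mul_lt_of_not_isPos b i w⟩
  have := length_simple_mul_lt_of_not_isPos b i (simple b i * w)
    (by rw [mul_inv_rev, simple_inv, isPos_mul_simple_smul_iff]; exact not_not.2 hp)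
  rw [simple_mul_cancel_left] at this
  omega

lemma length_simple_mul_of_isPos (i : b.support) (w : P.weylGroup)
    (h : b.IsPos (w⁻¹ • (i : ι))) : length b (simple b i * w) = length b w + 1 := by
  have h1 := length_simple_mul_lt_of_not_isPos b i (simple b i * w)
    (by rw [mul_inv_rev, simple_inv, isPos_mul_simple_smul_iff]; exact not_not.2 h)
  rw [simple_mul_cancel_left] at h1
  have h2 := length_simple_mul_le b i w
  omega

lemma length_simple_mul_of_not_isPos (i : b.support) (w : P.weylGroup)
    (h : ¬ b.IsPos (w⁻¹ • (i : ι))) : length b (simple b i * w) + 1 = length b w := by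
  have h1 := length_simple_mul_lt_of_not_isPos b i w h
  have h2 := length_le_simple_mul b i w
  omega

lemma length_lt_simple_mul_iff (i : b.support) (w : P.weylGroup) :
    length b w < length b (simple b i * w) ↔ b.IsPos (w⁻¹ • (i : ι)) := by
  by_cases h : b.IsPos (w⁻¹ • (i : ι))
  · simp [h, length_simple_mul_of_isPos]
  · simp only [h, iff_false, not_lt]
    exact (length_simple_mul_lt_of_not_isPos b i w h).le

lemma length_mul_simple (w : P.weylGroup) (i : b.support) :
    length b (w * simple b i) = length b (simple b i * w⁻¹) := by
  rw [← length_inv, mul_inv_rev, simple_inv]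

lemma length_mul_simple_of_isPos (w : P.weylGroup) (i : b.support) (h : b.IsPos (w • (i : ι))) :
    length b (w * simple b i) = length b w + 1 := by
  rw [length_mul_simple, length_simple_mul_of_isPos b i _ (by rwa [inv_inv]), length_inv]

lemma length_mul_simple_of_not_isPos (w : P.weylGroup) (i : b.support)
    (h : ¬ b.IsPos (w • (i : ι))) : length b (w * simple b i) + 1 = length b w := by
  rw [length_mul_simple, length_simple_mul_of_not_isPos b i _ (by rwa [inv_inv]), length_inv]

lemma length_lt_mul_simple_iff (w : P.weylGroup) (i : b.support) :
    length b w < length b (w * simple b i) ↔ b.IsPos (w • (i : ι)) := by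
  rw [length_mul_simple, ← length_inv b w, length_lt_simple_mul_iff, inv_inv]

/-- An element of the Weyl group without right descents is trivial. -/
lemma eq_one_of_forall_isPos_smul (w : P.weylGroup)
    (h : ∀ i : b.support, b.IsPos (w • (i : ι))) : w = 1 := by
  rw [← wordProd_reducedWord b w]
  rcases hl : (reducedWord b w).reverse with _ | ⟨i, l⟩
  · simp [List.reverse_eq_nil_iff.1 hl]
  · exfalso
    have hw : reducedWord b w = l.reverse ++ [i] := by
      rw [← List.reverse_reverse (reducedWord b w), hl, List.reverse_cons]
    have h1 := length_mul_simple_of_isPos b w i (h i)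
    have h2 : w * simple b i = wordProd b l.reverse := by
      conv_lhs => rw [← wordProd_reducedWord b w, hw]
      simp
    have h3 := length_wordProd_le b l.reverse
    have h4 : length b w = l.length + 1 := by rw [length, hw]; simp
    rw [← h2, h1, h4, List.length_reverse] at h3
    omega

/-- The action on the finite set of root indices is faithful: if `v` and `w` act alike, then `v⁻¹w`
fixes all simple roots and so has no descents. -/
lemma finite_weylGroup (b : P.Base) : Finite P.weylGroup := by
  refine Finite.of_injective (fun w : P.weylGroup ↦ fun k : ι ↦ w • k) fun v w h ↦ ?_
  rw [← inv_mul_eq_one]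
  refine eq_one_of_forall_isPos_smul b _ fun i ↦ ?_
  have : w • (i : ι) = v • (i : ι) := (congrFun h i).symm
  rw [mul_smul, this, inv_smul_smul]
  exact isPos_simple b i

lemma simple_injective : Function.Injective (simple b) := by
  intro i j h
  by_contra hij
  have h1 := isPos_simple_smul (i := j) (isPos_simple b i) (fun h ↦ hij (Subtype.ext h))
  rw [← h] at h1
  exact not_isPos_simple_smul_self b i h1

end WeylCombinatorics

/-! ### Alternating words and Matsumoto's theorem -/

section Matsumoto

open RootPairing

/-- The alternating word `[x, y, x, …]` with `n` letters. -/
def altWord {α : Type*} : ℕ → α → α → List α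
  | 0, _, _ => []
  | n + 1, x, y => x :: altWord n y x

@[simp] lemma altWord_zero {α : Type*} (x y : α) : altWord 0 x y = [] := rfl

@[simp] lemma altWord_succ {α : Type*} (n : ℕ) (x y : α) :
    altWord (n + 1) x y = x :: altWord n y x := rfl

@[simp] lemma length_altWord {α : Type*} (n : ℕ) (x y : α) : (altWord n x y).length = n := by
  induction n generalizing x y with
  | zero => rfl
  | succ n ih => simp [ih]

lemma prod_map_altWord {α A : Type*} [Monoid A] (f : α → A) (n : ℕ) (x y : α) :
    ((altWord n x y).map f).prod = altProd n (f x) (f y) := by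
  induction n generalizing x y with
  | zero => rfl
  | succ n ih => simp [ih, altProd]

lemma eraseIdx_altWord_last {α : Type*} (n : ℕ) (x y : α) :
    (altWord (n + 1) x y).eraseIdx n = altWord n x y := by
  induction n generalizing x y with
  | zero => rfl
  | succ n ih => rw [altWord_succ, List.eraseIdx_cons_succ, ih, altWord_succ]

variable {ι M N : Type*} [AddCommGroup M] [AddCommGroup N] {P : RootPairing ι ℤ M N}
  (b : P.Base)

/-- Deleting an interior letter of an alternating word makes two equal letters adjacent. They
cancel, so three letters are lost in total. -/
lemma exists_wordProd_eq_eraseIdx_altWord (n p : ℕ) (x y : b.support) :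
    ∃ l : List b.support, l.length = n + p ∧
      wordProd b l = wordProd b ((altWord (n + p + 3) x y).eraseIdx (p + 1)) := by
  induction p generalizing x y with
  | zero => exact ⟨altWord n y x, by simp, by simp⟩
  | succ p ih =>
    obtain ⟨l, hl, hl'⟩ := ih y x
    refine ⟨x :: l, by simp [hl, add_assoc], ?_⟩
    rw [show n + (p + 1) + 3 = n + p + 3 + 1 by ring, altWord_succ, List.eraseIdx_cons_succ,
      wordProd_cons, wordProd_cons, hl']

/-- Conjugation by `s_x` inverts `s_x s_y`. When `n` is the order of `s_x s_y`, this makes the two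
alternating products equal. -/
lemma wordProd_altWord_eq_pow_mul (n : ℕ) (x y : b.support) :
    wordProd b (altWord n x y) = (simple b x * simple b y) ^ n * wordProd b (altWord n y x) := by
  induction n with
  | zero => simp
  | succ n ih =>
    have h1 : (simple b x * simple b y) ^ n * simple b x =
        simple b x * ((simple b x * simple b y) ^ n)⁻¹ := by
      rw [← inv_pow, mul_inv_rev, simple_inv, simple_inv]
      exact (SemiconjBy.pow_right (a := simple b x) (x := simple b y * simple b x)
        (y := simple b x * simple b y) (by simp [SemiconjBy, mul_assoc]) n).eq.symm
    have h2 : wordProd b (altWord n y x) =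
        ((simple b x * simple b y) ^ n)⁻¹ * wordProd b (altWord n x y) := by
      rw [ih, inv_mul_cancel_left]
    rw [altWord_succ, altWord_succ, wordProd_cons, wordProd_cons, h2, ← mul_assoc, ← h1, pow_succ]
    simp only [mul_assoc, simple_mul_cancel_left]

lemma orderOf_simple_mul_comm (x y : b.support) :
    orderOf (simple b y * simple b x) = orderOf (simple b x * simple b y) := by
  rw [← orderOf_inv, mul_inv_rev, simple_inv, simple_inv]

lemma wordProd_altWord_comm (x y : b.support) :
    wordProd b (altWord (orderOf (simple b x * simple b y)) x y) =
      wordProd b (altWord (orderOf (simple b x * simple b y)) y x) := by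
  rw [wordProd_altWord_eq_pow_mul, pow_orderOf_eq_one, one_mul]

variable [Finite ι] [P.IsReduced]

variable {b} in
lemma IsReducedWord.of_append_right {l l' : List b.support} (h : IsReducedWord b (l ++ l')) :
    IsReducedWord b l' := by
  rw [isReducedWord_iff] at h ⊢
  have h1 := length_mul_le b (wordProd b l) (wordProd b l')
  have h2 := length_wordProd_le b l
  have h3 := length_wordProd_le b l'
  rw [← wordProd_append, h, List.length_append] at h1
  omega

variable {b} in
lemma IsReducedWord.of_cons {i : b.support} {l : List b.support} (h : IsReducedWord b (i :: l)) :
    IsReducedWord b l :=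
  IsReducedWord.of_append_right (l := [i]) h

variable {b} in
lemma IsReducedWord.of_wordProd_eq {l l' : List b.support} (h : IsReducedWord b l)
    (hp : wordProd b l' = wordProd b l) (hl : l'.length = l.length) : IsReducedWord b l' := by
  rw [isReducedWord_iff] at h ⊢
  rw [hp, h, hl]

variable {b} in
lemma IsReducedWord.not_isPos {i : b.support} {l : List b.support}
    (h : IsReducedWord b (i :: l)) : ¬ b.IsPos ((wordProd b (i :: l))⁻¹ • (i : ι)) := by
  rw [← length_simple_mul_lt_iff, (isReducedWord_iff b _).1 h, wordProd_cons,
    simple_mul_cancel_left]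
  exact Nat.lt_succ_of_le (length_wordProd_le b l)

/-- If prepending a letter to a reduced alternating word shortened the element, exchange would
delete a letter of that word. Deleting the first gives `s_x = s_y`, deleting the last gives a power
of `s_x s_y` below its order equal to 1, and deleting an interior one shortens by more than a simple
reflection can. -/
lemma isReducedWord_altWord {x y : b.support} (hxy : x ≠ y) (n : ℕ)
    (hn : n ≤ orderOf (simple b x * simple b y)) : IsReducedWord b (altWord n x y) := by
  induction n generalizing x y with
  | zero => intro l _; simp
  | succ k ih =>
    have hu : IsReducedWord b (altWord k y x) :=
      ih hxy.symm (by rw [orderOf_simple_mul_comm]; omega)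
    rw [isReducedWord_iff, length_altWord] at hu
    by_cases hpos : b.IsPos ((wordProd b (altWord k y x))⁻¹ • (x : ι))
    · rw [isReducedWord_iff, altWord_succ, wordProd_cons, length_simple_mul_of_isPos b x _ hpos, hu,
        List.length_cons, length_altWord]
    exfalso
    have hlen := length_simple_mul_of_not_isPos b x _ hpos
    obtain ⟨p, hp, hp'⟩ := exists_eraseIdx_of_not_isPos b _ x (isPos_simple b x) hpos
    change simple b x * _ = _ at hp'
    rw [length_altWord] at hp
    rcases p with _ | p
    · obtain ⟨k, rfl⟩ : ∃ k', k = k' + 1 := ⟨k - 1, by omega⟩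
      rw [altWord_succ, List.eraseIdx_cons_zero, wordProd_cons, ← mul_assoc] at hp'
      have h1 := mul_eq_right.1 hp'
      rw [mul_eq_one_iff_eq_inv, simple_inv] at h1
      exact hxy (simple_injective b h1)
    · by_cases hpk : p + 2 = k
      · subst hpk
        rw [eraseIdx_altWord_last] at hp'
        have h1 : simple b x * wordProd b (altWord (p + 2) y x) =
            (simple b x * simple b y) ^ (p + 2) * wordProd b (altWord (p + 1) y x) := by
          rw [altWord_succ, wordProd_cons, wordProd_altWord_eq_pow_mul, ← mul_assoc, ← mul_assoc,
            ← pow_succ']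
        rw [h1] at hp'
        exact pow_ne_one_of_lt_orderOf (by omega) (by omega) (mul_eq_right.1 hp')
      · obtain ⟨n, rfl⟩ : ∃ n, k = n + p + 3 := ⟨k - p - 3, by omega⟩
        obtain ⟨l, hl, hl'⟩ := exists_wordProd_eq_eraseIdx_altWord b n p y x
        have h1 := length_wordProd_le b l
        rw [hl', ← hp'] at h1
        omega

/-- The alternating prefix grows by one letter at a time: exchange puts the other descent in front
and deletes a letter, which cannot lie in the prefix because the longer alternating word is reduced.
The first letter changes at each step, hence the disjunction. -/
lemma exists_isReducedWord_altWord_append_aux {i j : b.support} (hij : i ≠ j) (w : P.weylGroup)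
    (hi : ¬ b.IsPos (w⁻¹ • (i : ι))) (hj : ¬ b.IsPos (w⁻¹ • (j : ι))) (k : ℕ)
    (hk : k ≤ orderOf (simple b i * simple b j)) :
    ∃ l : List b.support,
      (IsReducedWord b (altWord k i j ++ l) ∧ wordProd b (altWord k i j ++ l) = w) ∨
      (IsReducedWord b (altWord k j i ++ l) ∧ wordProd b (altWord k j i ++ l) = w) := by
  have step : ∀ {i j : b.support}, i ≠ j → ¬ b.IsPos (w⁻¹ • (j : ι)) → ∀ k l,
      k + 1 ≤ orderOf (simple b i * simple b j) → IsReducedWord b (altWord k i j ++ l) →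
      wordProd b (altWord k i j ++ l) = w → ∃ l' : List b.support,
        IsReducedWord b (altWord (k + 1) j i ++ l') ∧
          wordProd b (altWord (k + 1) j i ++ l') = w := by
    intro i j hij hj k l hk hl hw
    obtain ⟨p, hp, hp'⟩ := exists_eraseIdx_of_not_isPos b (altWord k i j ++ l) j (isPos_simple b j)
      (by rwa [hw])
    change simple b j * _ = _ at hp'
    by_cases hpk : p < k
    · exfalso
      rw [List.eraseIdx_append_of_lt_length (by simpa), wordProd_append, wordProd_append,
        ← mul_assoc, mul_left_inj] at hp'
      have h1 := isReducedWord_altWord b hij.symm (k + 1) (by rwa [orderOf_simple_mul_comm])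
      have h2 := h1 ((altWord k i j).eraseIdx p) (by rw [altWord_succ, wordProd_cons]; exact hp'.symm)
      rw [List.length_eraseIdx_of_lt (by simpa), length_altWord, length_altWord] at h2
      omega
    · rw [List.eraseIdx_append_of_length_le (by simpa using hpk), length_altWord] at hp'
      rw [List.length_append, length_altWord] at hp
      have h1 : wordProd b (altWord (k + 1) j i ++ l.eraseIdx (p - k)) = w := by
        rw [altWord_succ, List.cons_append, wordProd_cons, ← hp', simple_mul_cancel_left, hw]
      refine ⟨_, hl.of_wordProd_eq (h1.trans hw.symm) ?_, h1⟩
      rw [List.length_append, List.length_append, length_altWord, length_altWord,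
        List.length_eraseIdx_of_lt (by omega)]
      omega
  induction k with
  | zero => exact ⟨reducedWord b w, .inl ⟨isReducedWord_reducedWord b w, wordProd_reducedWord b w⟩⟩
  | succ k ih =>
    obtain ⟨l, ⟨h1, h2⟩ | ⟨h1, h2⟩⟩ := ih (by omega)
    · exact (step hij hj k l hk h1 h2).imp fun _ ↦ Or.inr
    · exact (step hij.symm hi k l (by rwa [orderOf_simple_mul_comm]) h1 h2).imp fun _ ↦ Or.inl

/-- An element with two distinct left descents has reduced words starting with both longest
alternating words. -/
lemma exists_isReducedWord_altWord_append {i j : b.support} (hij : i ≠ j) (w : P.weylGroup)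
    (hi : ¬ b.IsPos (w⁻¹ • (i : ι))) (hj : ¬ b.IsPos (w⁻¹ • (j : ι))) :
    ∃ l : List b.support,
      (IsReducedWord b (altWord (orderOf (simple b i * simple b j)) i j ++ l) ∧
        wordProd b (altWord (orderOf (simple b i * simple b j)) i j ++ l) = w) ∧
      (IsReducedWord b (altWord (orderOf (simple b i * simple b j)) j i ++ l) ∧
        wordProd b (altWord (orderOf (simple b i * simple b j)) j i ++ l) = w) := by
  obtain ⟨l, h⟩ := exists_isReducedWord_altWord_append_aux b hij w hi hj _ le_rfl
  have key : wordProd b (altWord (orderOf (simple b i * simple b j)) i j ++ l) =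
      wordProd b (altWord (orderOf (simple b i * simple b j)) j i ++ l) := by
    rw [wordProd_append, wordProd_append, wordProd_altWord_comm]
  refine ⟨l, ?_⟩
  rcases h with ⟨h1, h2⟩ | ⟨h1, h2⟩
  · exact ⟨⟨h1, h2⟩, h1.of_wordProd_eq key.symm (by simp), key ▸ h2⟩
  · exact ⟨⟨h1.of_wordProd_eq key (by simp), key.trans h2⟩, h1, h2⟩

/-- Matsumoto's theorem: two reduced words of the same element are related by braid moves. -/
theorem matsumoto {r : List b.support → List b.support → Prop} (hr : Equivalence r)
    (hcons : ∀ i l l', r l l' → r (i :: l) (i :: l'))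
    (hbraid : ∀ i j : b.support, i ≠ j → ∀ l,
      r (altWord (orderOf (simple b i * simple b j)) i j ++ l)
        (altWord (orderOf (simple b i * simple b j)) j i ++ l))
    {l l' : List b.support} (hl : IsReducedWord b l) (hl' : IsReducedWord b l')
    (h : wordProd b l = wordProd b l') : r l l' := by
  have := finite_weylGroup b
  induction hn : l.length generalizing l l' with
  | zero =>
    have h1 := hl' l h
    rw [List.length_eq_zero_iff.1 hn, List.length_eq_zero_iff.1 (by omega : l'.length = 0)]
    exact hr.refl _
  | succ n ih =>
    have hlen : l'.length = n + 1 := by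
      have h1 := hl' l h
      have h2 := hl l' h.symm
      omega
    obtain ⟨i, u, rfl⟩ := List.exists_cons_of_length_eq_add_one hn
    obtain ⟨j, u', rfl⟩ := List.exists_cons_of_length_eq_add_one hlen
    have head : ∀ {i : b.support} {u u' : List b.support}, IsReducedWord b (i :: u) →
        IsReducedWord b (i :: u') → wordProd b (i :: u) = wordProd b (i :: u') →
        u.length = n → r (i :: u) (i :: u') := by
      intro i u u' h1 h2 h3 h4
      rw [wordProd_cons, wordProd_cons, mul_right_inj] at h3
      exact hcons i u u' (ih h1.of_cons h2.of_cons h3 h4)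
    have hu : u.length = n := by simpa using hn
    have hu' : u'.length = n := by simpa using hlen
    by_cases hij : i = j
    · subst hij
      exact head hl hl' h hu
    -- Different first letters are both descents of the same element. Each given word shares its
    -- first letter with one of two words that differ by a braid move, so induction applies to the
    -- tails.
    obtain ⟨x, ⟨h1, h2⟩, h3, h4⟩ := exists_isReducedWord_altWord_append b hij _ hl.not_isPos
      (by rw [h]; exact hl'.not_isPos)
    have hbr := hbraid i j hij x
    obtain ⟨m, hm⟩ : ∃ m, orderOf (simple b i * simple b j) = m + 1 :=
      Nat.exists_eq_add_one.2 (orderOf_pos _)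
    rw [hm] at h1 h2 h3 h4 hbr
    exact hr.trans (head hl h1 h2.symm hu)
      (hr.trans hbr (hr.symm (head hl' h3 (h.symm.trans h4.symm) hu')))

end Matsumoto

noncomputable section

/-! ### The standard basis of the Hecke algebra -/

section HeckeBasis

open RootPairing

variable {ι M N : Type*} [AddCommGroup M] [AddCommGroup N] {P : RootPairing ι ℤ M N}
  (b : P.Base)

section Generators

lemma mul_self_of_sub_algebraMap_mul {R A : Type*} [CommRing R] [Ring A] [Algebra R A] {a₁ a₂ : R}
    {h : A} (hh : (h - algebraMap R A a₁) * (h - algebraMap R A a₂) = 0) :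
    h * h = (a₁ + a₂) • h - (a₁ * a₂) • 1 := by
  simp only [Algebra.algebraMap_eq_smul_one, sub_mul, mul_sub, smul_mul_assoc, mul_smul_comm,
    one_mul, mul_one] at hh
  rw [← sub_eq_zero, ← hh]
  module

lemma gen_mul_self (i : b.support) :
    gen b i * gen b i = (t₁ M + t₂ M) • gen b i - (t₁ M * t₂ M) • 1 := by
  have h := RingQuot.mkAlgHom_rel (Coeff M) (HeckeRel.quadratic (a₁ := t₁ M) (a₂ := t₂ M) i)
  rw [map_mul, map_sub, map_sub, map_zero, AlgHom.commutes, AlgHom.commutes] at h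
  exact mul_self_of_sub_algebraMap_mul h

lemma map_altProd {A B : Type*} [Monoid A] [Monoid B] (f : A →* B) (n : ℕ) (x y : A) :
    f (altProd n x y) = altProd n (f x) (f y) := by
  induction n generalizing x y with
  | zero => exact map_one f
  | succ n ih => rw [altProd, altProd, map_mul, ih]

lemma altProd_gen_comm (i j : b.support) (hij : i ≠ j) :
    altProd (orderOf (simple b i * simple b j)) (gen b i) (gen b j) =
      altProd (orderOf (simple b i * simple b j)) (gen b j) (gen b i) := by
  have h := RingQuot.mkAlgHom_rel (Coeff M) (HeckeRel.braid (a₁ := t₁ M) (a₂ := t₂ M) i j hij)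
  have key := map_altProd
    (RingQuot.mkAlgHom (Coeff M) (HeckeRel b (t₁ M) (t₂ M))).toRingHom.toMonoidHom
  exact (key _ _ _).symm.trans (h.trans (key _ _ _))

end Generators

/-! ### Left and right regular operators. -/

section RegularRepresentation

variable {R : Type*} [CommRing R] (a₁ a₂ : R)

open Classical in
/-- The left action of the generator `h_i` on the free module over the Weyl group. -/
def leftOp (i : b.support) : Module.End R (P.weylGroup →₀ R) :=
  Finsupp.lsum R fun w ↦ LinearMap.toSpanSingleton R _
    (if b.IsPos (w⁻¹ • (i : ι)) then Finsupp.single (simple b i * w) 1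
      else (a₁ + a₂) • Finsupp.single w 1 - (a₁ * a₂) • Finsupp.single (simple b i * w) 1)

open Classical in
/-- The right action of the generator `h_i` on the free module over the Weyl group. -/
def rightOp (i : b.support) : Module.End R (P.weylGroup →₀ R) :=
  Finsupp.lsum R fun w ↦ LinearMap.toSpanSingleton R _
    (if b.IsPos (w • (i : ι)) then Finsupp.single (w * simple b i) 1
      else (a₁ + a₂) • Finsupp.single w 1 - (a₁ * a₂) • Finsupp.single (w * simple b i) 1)

lemma leftOp_single_of_isPos {i : b.support} {w : P.weylGroup} (h : b.IsPos (w⁻¹ • (i : ι))) :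
    leftOp b a₁ a₂ i (Finsupp.single w 1) = Finsupp.single (simple b i * w) 1 := by
  simp [leftOp, h]

lemma leftOp_single_of_not_isPos {i : b.support} {w : P.weylGroup}
    (h : ¬ b.IsPos (w⁻¹ • (i : ι))) :
    leftOp b a₁ a₂ i (Finsupp.single w 1) =
      (a₁ + a₂) • Finsupp.single w 1 - (a₁ * a₂) • Finsupp.single (simple b i * w) 1 := by
  simp [leftOp, h]

lemma rightOp_single_of_isPos {i : b.support} {w : P.weylGroup} (h : b.IsPos (w • (i : ι))) :
    rightOp b a₁ a₂ i (Finsupp.single w 1) = Finsupp.single (w * simple b i) 1 := by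
  simp [rightOp, h]

lemma rightOp_single_of_not_isPos {i : b.support} {w : P.weylGroup} (h : ¬ b.IsPos (w • (i : ι))) :
    rightOp b a₁ a₂ i (Finsupp.single w 1) =
      (a₁ + a₂) • Finsupp.single w 1 - (a₁ * a₂) • Finsupp.single (w * simple b i) 1 := by
  simp [rightOp, h]

end RegularRepresentation

variable [Finite ι] [P.IsReduced]

lemma isReducedWord_cons {i : b.support} {w : P.weylGroup} (h : b.IsPos (w⁻¹ • (i : ι))) :
    IsReducedWord b (i :: reducedWord b w) := by
  rw [isReducedWord_iff, wordProd_cons, wordProd_reducedWord, length_simple_mul_of_isPos b i w h,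
    List.length_cons, length]

lemma isReducedWord_concat {i : b.support} {w : P.weylGroup} (h : b.IsPos (w • (i : ι))) :
    IsReducedWord b (reducedWord b w ++ [i]) := by
  rw [isReducedWord_iff, wordProd_append, wordProd_reducedWord, wordProd_cons, wordProd_nil,
    mul_one, length_mul_simple_of_isPos b w i h, List.length_append, List.length_singleton, length]

section Generators

lemma prod_gen_eq_of_isReducedWord {l l' : List b.support} (hl : IsReducedWord b l)
    (hl' : IsReducedWord b l') (h : wordProd b l = wordProd b l') :
    (l.map (gen b)).prod = (l'.map (gen b)).prod := by
  refine matsumoto b (r := fun l l' ↦ (l.map (gen b)).prod = (l'.map (gen b)).prod)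
    ⟨fun _ ↦ rfl, Eq.symm, Eq.trans⟩ (fun i l l' h ↦ ?_) (fun i j hij l ↦ ?_) hl hl' h
  · simp [h]
  · simp [prod_map_altWord, altProd_gen_comm b i j hij]

lemma heckeElt_wordProd {l : List b.support} (hl : IsReducedWord b l) :
    heckeElt b (wordProd b l) = (l.map (gen b)).prod :=
  prod_gen_eq_of_isReducedWord b (isReducedWord_reducedWord b _) hl (wordProd_reducedWord b _)

lemma heckeElt_one : heckeElt b 1 = 1 := by
  have h := heckeElt_wordProd b (l := []) (by rw [isReducedWord_iff]; simp)
  simpa using h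

lemma gen_mul_heckeElt_of_isPos {i : b.support} {w : P.weylGroup} (h : b.IsPos (w⁻¹ • (i : ι))) :
    gen b i * heckeElt b w = heckeElt b (simple b i * w) := by
  have := heckeElt_wordProd b (isReducedWord_cons b h)
  rw [wordProd_cons, wordProd_reducedWord] at this
  rw [this, List.map_cons, List.prod_cons, heckeElt]

lemma heckeElt_mul_gen_of_isPos {i : b.support} {w : P.weylGroup} (h : b.IsPos (w • (i : ι))) :
    heckeElt b w * gen b i = heckeElt b (w * simple b i) := by
  have := heckeElt_wordProd b (isReducedWord_concat b h)
  rw [wordProd_append, wordProd_reducedWord, wordProd_cons, wordProd_nil, mul_one] at this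
  rw [this, List.map_append, List.prod_append, heckeElt, List.map_singleton, List.prod_singleton]

lemma gen_mul_heckeElt_of_not_isPos {i : b.support} {w : P.weylGroup}
    (h : ¬ b.IsPos (w⁻¹ • (i : ι))) :
    gen b i * heckeElt b w =
      (t₁ M + t₂ M) • heckeElt b w - (t₁ M * t₂ M) • heckeElt b (simple b i * w) := by
  have h' : b.IsPos ((simple b i * w)⁻¹ • (i : ι)) := by
    rwa [mul_inv_rev, simple_inv, isPos_mul_simple_smul_iff]
  have h1 := gen_mul_heckeElt_of_isPos b h'
  rw [simple_mul_cancel_left] at h1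
  rw [← h1, ← mul_assoc, gen_mul_self, sub_mul, smul_mul_assoc, smul_mul_assoc, one_mul]

lemma heckeElt_mul_gen_of_not_isPos {i : b.support} {w : P.weylGroup}
    (h : ¬ b.IsPos (w • (i : ι))) :
    heckeElt b w * gen b i =
      (t₁ M + t₂ M) • heckeElt b w - (t₁ M * t₂ M) • heckeElt b (w * simple b i) := by
  have h' : b.IsPos ((w * simple b i) • (i : ι)) := by rwa [isPos_mul_simple_smul_iff]
  have h1 := heckeElt_mul_gen_of_isPos b h'
  rw [mul_simple_cancel_right] at h1
  rw [← h1, mul_assoc, gen_mul_self, mul_sub, mul_smul_comm, mul_smul_comm, mul_one]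

end Generators

lemma ofIdx_smul (b : P.Base) (w : P.weylGroup) (k : ι) :
    weylGroup.ofIdx P (w • k) = w * weylGroup.ofIdx P k * w⁻¹ := by
  rw [← wordProd_reducedWord b w]
  induction reducedWord b w generalizing k with
  | nil => simp
  | cons i l ih => simp [mul_smul, ofIdx_simple_smul, ih, mul_assoc]

lemma mul_simple_eq_simple_mul {i j : b.support} {w : P.weylGroup} (h : w • (j : ι) = i) :
    w * simple b j = simple b i * w := by
  have h1 := ofIdx_smul b w j
  rw [h] at h1
  exact (eq_mul_inv_iff_mul_eq.1 h1).symm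

/-- `s_i` changes the sign of no roots except `±α_i`. -/
lemma isPos_simple_mul_smul_iff {i : b.support} {k : ι} {w : P.weylGroup} (h : w • k ≠ i)
    (h' : w • k ≠ P.reflectionPerm i i) :
    b.IsPos ((simple b i * w) • k) ↔ b.IsPos (w • k) := by
  rw [mul_smul]
  refine ⟨fun hp ↦ ?_, fun hp ↦ isPos_simple_smul hp h⟩
  have h1 : simple b i • (w • k) ≠ i := fun h1 ↦ h' <| by
    rw [← simple_smul_index, ← h1, ← mul_smul, simple_mul_self, one_smul]
  simpa [← mul_smul] using isPos_simple_smul hp h1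

section RegularRepresentation

variable {R : Type*} [CommRing R] (a₁ a₂ : R)

/-- Left multiplication by `s_i` can affect the right descent at `j`, and conversely, only if `wα_j
= ±α_i`, and then `s_i w = w s_j`. Outside these two cases the descent conditions are independent
and the four sign combinations are checked directly. -/
lemma commute_leftOp_rightOp (i j : b.support) :
    Commute (leftOp b a₁ a₂ i) (rightOp b a₁ a₂ j) := by
  refine Finsupp.lhom_ext' fun w ↦ LinearMap.ext_ring ?_
  change leftOp b a₁ a₂ i (rightOp b a₁ a₂ j (Finsupp.single w 1)) =
    rightOp b a₁ a₂ j (leftOp b a₁ a₂ i (Finsupp.single w 1))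
  by_cases h : w • (j : ι) = i
  · have h1 := mul_simple_eq_simple_mul b h
    have h2 : b.IsPos (w • (j : ι)) := h ▸ isPos_simple b i
    have h3 : b.IsPos (w⁻¹ • (i : ι)) := by
      rw [← h, inv_smul_smul]; exact isPos_simple b j
    have h4 : ¬ b.IsPos ((w * simple b j) • (j : ι)) := by
      rw [isPos_mul_simple_smul_iff]; exact not_not.2 h2
    have h5 : ¬ b.IsPos ((simple b i * w)⁻¹ • (i : ι)) := by
      rw [mul_inv_rev, simple_inv, isPos_mul_simple_smul_iff]; exact not_not.2 h3
    rw [rightOp_single_of_isPos b a₁ a₂ h2, leftOp_single_of_isPos b a₁ a₂ h3, h1,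
      leftOp_single_of_not_isPos b a₁ a₂ h5, ← h1, rightOp_single_of_not_isPos b a₁ a₂ h4,
      mul_simple_cancel_right, h1, simple_mul_cancel_left]
  by_cases h' : w • (j : ι) = P.reflectionPerm i i
  · have h1 : simple b i * w = w * simple b j := by
      have h0 : (simple b i * w) • (j : ι) = i := by
        rw [mul_smul, h', ← simple_smul_index, ← mul_smul, simple_mul_self, one_smul]
      have h1 := mul_simple_eq_simple_mul b h0
      rw [simple_mul_cancel_left] at h1
      conv_rhs => rw [← h1, mul_simple_cancel_right]
    have h2 : ¬ b.IsPos (w • (j : ι)) := by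
      rw [h', isPos_reflectionPerm_self_iff]; exact not_not.2 (isPos_simple b i)
    have h3 : ¬ b.IsPos (w⁻¹ • (i : ι)) := by
      rw [← isPos_smul_reflectionPerm_self_iff, ← h', inv_smul_smul]; exact isPos_simple b j
    have h4 : b.IsPos ((w * simple b j) • (j : ι)) := by rwa [isPos_mul_simple_smul_iff]
    have h5 : b.IsPos ((simple b i * w)⁻¹ • (i : ι)) := by
      rwa [mul_inv_rev, simple_inv, isPos_mul_simple_smul_iff]
    rw [rightOp_single_of_not_isPos b a₁ a₂ h2, leftOp_single_of_not_isPos b a₁ a₂ h3,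
      map_sub, map_sub, map_smul, map_smul, map_smul, map_smul,
      rightOp_single_of_not_isPos b a₁ a₂ h2, leftOp_single_of_not_isPos b a₁ a₂ h3, h1,
      rightOp_single_of_isPos b a₁ a₂ h4, ← h1, leftOp_single_of_isPos b a₁ a₂ h5, h1,
      mul_simple_cancel_right, ← h1, simple_mul_cancel_left]
  · have key : b.IsPos ((simple b i * w) • (j : ι)) ↔ b.IsPos (w • (j : ι)) :=
      isPos_simple_mul_smul_iff b h h'
    have key' : b.IsPos ((w * simple b j)⁻¹ • (i : ι)) ↔ b.IsPos (w⁻¹ • (i : ι)) := by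
      rw [mul_inv_rev, simple_inv]
      refine isPos_simple_mul_smul_iff b (fun h1 ↦ h ?_) (fun h1 ↦ h' ?_)
      · rw [← h1, smul_inv_smul]
      · have h2 : simple b j • w⁻¹ • (i : ι) = j := by
          rw [h1, ← simple_smul_index, ← mul_smul, simple_mul_self, one_smul]
        have h3 : (w * simple b j) • (j : ι) = i := by
          rw [← h2, mul_smul, ← mul_smul (simple b j), simple_mul_self, one_smul, smul_inv_smul]
        have h4 := mul_simple_eq_simple_mul b h3
        rw [mul_simple_cancel_right] at h4
        conv_lhs => rw [h4, mul_smul, h3]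
        rfl
    by_cases hL : b.IsPos (w⁻¹ • (i : ι)) <;> by_cases hR : b.IsPos (w • (j : ι))
    · rw [rightOp_single_of_isPos b a₁ a₂ hR, leftOp_single_of_isPos b a₁ a₂ hL,
        leftOp_single_of_isPos b a₁ a₂ (key'.2 hL), rightOp_single_of_isPos b a₁ a₂ (key.2 hR),
        mul_assoc]
    · rw [rightOp_single_of_not_isPos b a₁ a₂ hR, leftOp_single_of_isPos b a₁ a₂ hL,
        rightOp_single_of_not_isPos b a₁ a₂ (mt key.1 hR), map_sub, map_smul, map_smul,
        leftOp_single_of_isPos b a₁ a₂ hL, leftOp_single_of_isPos b a₁ a₂ (key'.2 hL), mul_assoc]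
    · rw [rightOp_single_of_isPos b a₁ a₂ hR, leftOp_single_of_not_isPos b a₁ a₂ hL,
        leftOp_single_of_not_isPos b a₁ a₂ (mt key'.1 hL), map_sub, map_smul, map_smul,
        rightOp_single_of_isPos b a₁ a₂ hR, rightOp_single_of_isPos b a₁ a₂ (key.2 hR), mul_assoc]
    · rw [rightOp_single_of_not_isPos b a₁ a₂ hR, leftOp_single_of_not_isPos b a₁ a₂ hL,
        map_sub, map_sub, map_smul, map_smul, map_smul, map_smul,
        rightOp_single_of_not_isPos b a₁ a₂ hR, leftOp_single_of_not_isPos b a₁ a₂ hL,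
        leftOp_single_of_not_isPos b a₁ a₂ (mt key'.1 hL),
        rightOp_single_of_not_isPos b a₁ a₂ (mt key.1 hR), mul_assoc]
      simp only [smul_sub, smul_smul]
      rw [mul_comm (a₁ * a₂) (a₁ + a₂)]
      abel

/-- Products of left operators along reduced words send the basis vector at `1` to the basis
vector at the product. -/
lemma prod_leftOp_single_one {l : List b.support} (hl : IsReducedWord b l) :
    (l.map (leftOp b a₁ a₂)).prod (Finsupp.single 1 1) = Finsupp.single (wordProd b l) 1 := by
  induction l with
  | nil => simp
  | cons i l ih =>
    have h : b.IsPos ((wordProd b l)⁻¹ • (i : ι)) := by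
      rw [← length_lt_simple_mul_iff, ← wordProd_cons, (isReducedWord_iff b _).1 hl,
        (isReducedWord_iff b _).1 hl.of_cons]
      simp
    rw [List.map_cons, List.prod_cons, Module.End.mul_apply, ih hl.of_cons,
      leftOp_single_of_isPos b a₁ a₂ h, wordProd_cons]

lemma prod_rightOp_single_one {l : List b.support} (hl : IsReducedWord b l) :
    (l.map (rightOp b a₁ a₂)).prod (Finsupp.single 1 1) =
      Finsupp.single (wordProd b l)⁻¹ 1 := by
  induction l with
  | nil => simp
  | cons i l ih =>
    have h : b.IsPos ((wordProd b l)⁻¹ • (i : ι)) := by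
      rw [← length_lt_simple_mul_iff, ← wordProd_cons, (isReducedWord_iff b _).1 hl,
        (isReducedWord_iff b _).1 hl.of_cons]
      simp
    rw [List.map_cons, List.prod_cons, Module.End.mul_apply, ih hl.of_cons,
      rightOp_single_of_isPos b a₁ a₂ h, wordProd_cons, mul_inv_rev, simple_inv]

/-- An endomorphism commuting with the right operators is determined by its value at `1`. -/
lemma eq_of_commute_rightOp {f g : Module.End R (P.weylGroup →₀ R)}
    (hf : ∀ i, Commute f (rightOp b a₁ a₂ i)) (hg : ∀ i, Commute g (rightOp b a₁ a₂ i))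
    (h : f (Finsupp.single 1 1) = g (Finsupp.single 1 1)) : f = g := by
  refine Finsupp.lhom_ext' fun w ↦ LinearMap.ext_ring ?_
  -- Right operators reach every basis vector from the one at `1`. The rightmost operator acts
  -- first, so a word of `w⁻¹` is needed to reach `w`.
  have h1 := prod_rightOp_single_one b a₁ a₂ (isReducedWord_reducedWord b w⁻¹)
  rw [wordProd_reducedWord, inv_inv] at h1
  have h2 {f : Module.End R (P.weylGroup →₀ R)} (hf : ∀ i, Commute f (rightOp b a₁ a₂ i)) :
      Commute f ((reducedWord b w⁻¹).map (rightOp b a₁ a₂)).prod :=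
    Commute.list_prod_right _ _ fun x hx ↦ by
      obtain ⟨i, -, rfl⟩ := List.mem_map.1 hx
      exact hf i
  change f (Finsupp.single w 1) = g (Finsupp.single w 1)
  rw [← h1, ← Module.End.mul_apply, ← Module.End.mul_apply, (h2 hf).eq, (h2 hg).eq,
    Module.End.mul_apply, Module.End.mul_apply, h]

/-- Both sides commute with the right operators, so it suffices to compare them at the basis vector
of `1`; the braid relation is proved the same way. -/
lemma leftOp_quadratic (i : b.support) :
    (leftOp b a₁ a₂ i - algebraMap R _ a₁) * (leftOp b a₁ a₂ i - algebraMap R _ a₂) = 0 := by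
  have hc (a : R) (j : b.support) : Commute (leftOp b a₁ a₂ i - algebraMap R _ a)
      (rightOp b a₁ a₂ j) :=
    Commute.sub_left (R := Module.End R (P.weylGroup →₀ R)) (commute_leftOp_rightOp b a₁ a₂ i j)
      (Algebra.commute_algebraMap_left a _)
  refine eq_of_commute_rightOp b a₁ a₂ (fun j ↦ (hc a₁ j).mul_left (hc a₂ j))
    (fun j ↦ Commute.zero_left _) ?_
  have h1 : b.IsPos ((1 : P.weylGroup)⁻¹ • (i : ι)) := by simpa using isPos_simple b i
  have h2 : ¬ b.IsPos ((simple b i)⁻¹ • (i : ι)) := by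
    rw [simple_inv]; exact not_isPos_simple_smul_self b i
  simp only [Module.End.mul_apply, LinearMap.sub_apply, Module.algebraMap_end_apply, map_sub,
    map_smul, leftOp_single_of_isPos b a₁ a₂ h1, mul_one,
    leftOp_single_of_not_isPos b a₁ a₂ h2, simple_mul_self, LinearMap.zero_apply]
  module

lemma leftOp_braid {i j : b.support} (hij : i ≠ j) :
    altProd (orderOf (simple b i * simple b j)) (leftOp b a₁ a₂ i) (leftOp b a₁ a₂ j) =
      altProd (orderOf (simple b i * simple b j)) (leftOp b a₁ a₂ j) (leftOp b a₁ a₂ i) := by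
  rw [← prod_map_altWord, ← prod_map_altWord]
  have hc (l : List b.support) (k : b.support) :
      Commute (l.map (leftOp b a₁ a₂)).prod (rightOp b a₁ a₂ k) :=
    Commute.list_prod_left _ _ fun x hx ↦ by
      obtain ⟨i, -, rfl⟩ := List.mem_map.1 hx
      exact commute_leftOp_rightOp b a₁ a₂ i k
  refine eq_of_commute_rightOp b a₁ a₂ (hc _) (hc _) ?_
  rw [prod_leftOp_single_one b a₁ a₂ (isReducedWord_altWord b hij _ le_rfl),
    prod_leftOp_single_one b a₁ a₂ (isReducedWord_altWord b hij.symm _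
      (orderOf_simple_mul_comm b i j).ge), wordProd_altWord_comm]

lemma lift_leftOp_eq_of_heckeRel {x y : FreeAlgebra R b.support} (h : HeckeRel b a₁ a₂ x y) :
    FreeAlgebra.lift R (leftOp b a₁ a₂) x = FreeAlgebra.lift R (leftOp b a₁ a₂) y := by
  cases h with
  | quadratic i =>
    simp only [map_mul, map_sub, FreeAlgebra.lift_ι_apply, AlgHom.commutes, map_zero]
    exact leftOp_quadratic b a₁ a₂ i
  | braid i j hij =>
    have key := map_altProd (FreeAlgebra.lift R (leftOp b a₁ a₂)).toRingHom.toMonoidHom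
    refine (key _ _ _).trans (Eq.trans ?_ (key _ _ _).symm)
    simpa using leftOp_braid b a₁ a₂ hij

end RegularRepresentation

section Basis

/-- The left regular representation of the Hecke algebra on the free module over the Weyl
group. -/
def regularRep : Hecke b →ₐ[Coeff M] Module.End (Coeff M) (P.weylGroup →₀ Coeff M) :=
  RingQuot.liftAlgHom (Coeff M) ⟨FreeAlgebra.lift (Coeff M) (leftOp b (t₁ M) (t₂ M)),
    fun _ _ h ↦ lift_leftOp_eq_of_heckeRel b _ _ h⟩

lemma regularRep_gen (i : b.support) : regularRep b (gen b i) = leftOp b (t₁ M) (t₂ M) i := by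
  simp [regularRep, gen]

lemma regularRep_heckeElt_single_one (w : P.weylGroup) :
    regularRep b (heckeElt b w) (Finsupp.single 1 1) = Finsupp.single w 1 := by
  have h := prod_leftOp_single_one b (t₁ M) (t₂ M) (isReducedWord_reducedWord b w)
  rw [wordProd_reducedWord] at h
  rw [heckeElt, map_list_prod, List.map_map, ← h]
  simp only [Function.comp_def, regularRep_gen]

/-- Acting on the basis vector of `1` in the regular representation turns the `h_w` into the
standard basis. -/
lemma linearIndependent_heckeElt :
    LinearIndependent (Coeff M) (heckeElt b : P.weylGroup → Hecke b) := by
  refine LinearIndependent.of_comp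
    ((LinearMap.applyₗ (Finsupp.single 1 1)).comp (regularRep b).toLinearMap) ?_
  convert (Finsupp.basisSingleOne (R := Coeff M) (ι := P.weylGroup)).linearIndependent using 1
  funext w
  simpa using regularRep_heckeElt_single_one b w

lemma gen_mul_mem_span_heckeElt (i : b.support) {g : Hecke b}
    (hg : g ∈ Submodule.span (Coeff M) (Set.range (heckeElt b))) :
    gen b i * g ∈ Submodule.span (Coeff M) (Set.range (heckeElt b)) := by
  have hmem (w : P.weylGroup) : heckeElt b w ∈
      Submodule.span (Coeff M) (Set.range (heckeElt b)) := Submodule.subset_span ⟨w, rfl⟩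
  induction hg using Submodule.span_induction with
  | mem x hx =>
    obtain ⟨w, rfl⟩ := hx
    by_cases h : b.IsPos (w⁻¹ • (i : ι))
    · rw [gen_mul_heckeElt_of_isPos b h]
      exact hmem _
    · rw [gen_mul_heckeElt_of_not_isPos b h]
      exact sub_mem (Submodule.smul_mem _ _ (hmem _)) (Submodule.smul_mem _ _ (hmem _))
  | zero => rw [mul_zero]; exact zero_mem _
  | add x y _ _ hx hy => rw [mul_add]; exact add_mem hx hy
  | smul c x _ hx => rw [mul_smul_comm]; exact Submodule.smul_mem _ _ hx

/-- The span is stable under left multiplication by generators and contains `h_1 = 1`, so it is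
everything. -/
lemma span_heckeElt : ⊤ ≤ Submodule.span (Coeff M) (Set.range (heckeElt b : _ → Hecke b)) := by
  intro g _
  suffices h : ∀ g : Hecke b, ∀ x ∈ Submodule.span (Coeff M) (Set.range (heckeElt b)),
      g * x ∈ Submodule.span (Coeff M) (Set.range (heckeElt b)) by
    simpa using h g 1 (Submodule.subset_span ⟨1, heckeElt_one b⟩)
  intro g
  obtain ⟨g, rfl⟩ := RingQuot.mkAlgHom_surjective (Coeff M) (HeckeRel b (t₁ M) (t₂ M)) g
  induction g using FreeAlgebra.induction with
  | grade0 r =>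
    intro x hx
    rw [AlgHom.commutes, ← Algebra.smul_def]
    exact Submodule.smul_mem _ _ hx
  | grade1 i => exact fun x hx ↦ gen_mul_mem_span_heckeElt b i hx
  | mul f g hf hg =>
    intro x hx
    rw [map_mul, mul_assoc]
    exact hf _ (hg _ hx)
  | add f g hf hg =>
    intro x hx
    rw [map_add, add_mul]
    exact add_mem (hf _ hx) (hg _ hx)

/-- The standard basis `(h_w)` of the Hecke algebra. -/
def heckeBasis : Module.Basis P.weylGroup (Coeff M) (Hecke b) :=
  Module.Basis.mk (linearIndependent_heckeElt b) (span_heckeElt b)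

@[simp] lemma heckeBasis_apply (w : P.weylGroup) : heckeBasis b w = heckeElt b w :=
  Module.Basis.mk_apply _ _ w

end Basis

end HeckeBasis

end

/-! ### The Yang–Baxter relations in rank two -/

section RankTwoAlgebra

variable {R A : Type*} [CommRing R] [Ring A] [Algebra R A] {T q : R} {x y : A}

lemma yangBaxter_two (h : x * y = y * x) (a₁ a₂ : R) :
    (x + algebraMap R A a₁) * (y + algebraMap R A a₂) =
      (y + algebraMap R A a₂) * (x + algebraMap R A a₁) := by
  simp only [Algebra.algebraMap_eq_smul_one, add_mul, mul_add, smul_mul_assoc, mul_smul_comm,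
    one_mul, mul_one, h]
  module

/-- After expansion only the coefficients of `x` and `y` fail to cancel identically, and `ha` is
their vanishing. The parameters occur in reverse order on the right because the other reduced word
meets the roots in reverse order. -/
lemma yangBaxter_three (hx : x * x = T • x - q • 1) (hy : y * y = T • y - q • 1)
    (h : x * (y * x) = y * (x * y)) {a₁ a₂ a₃ : R}
    (ha : T * a₂ + a₁ * a₂ - a₁ * a₃ + a₂ * a₃ = 0) :
    (x + algebraMap R A a₁) * ((y + algebraMap R A a₂) * (x + algebraMap R A a₃)) =
      (y + algebraMap R A a₃) * ((x + algebraMap R A a₂) * (y + algebraMap R A a₁)) := by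
  simp only [Algebra.algebraMap_eq_smul_one, add_mul, mul_add, smul_mul_assoc, mul_smul_comm,
    one_mul, mul_one, hx, hy, h]
  linear_combination (norm := module) ha • x - ha • y

lemma yangBaxter_four (hx : x * x = T • x - q • 1) (hy : y * y = T • y - q • 1)
    (h : x * (y * (x * y)) = y * (x * (y * x))) {a₁ a₂ a₃ a₄ : R}
    (ha : T * a₂ + T * a₃ + a₁ * a₂ - a₁ * a₄ + a₂ * a₃ + a₃ * a₄ = 0) :
    (x + algebraMap R A a₁) * ((y + algebraMap R A a₂) * ((x + algebraMap R A a₃) *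
        (y + algebraMap R A a₄))) =
      (y + algebraMap R A a₄) * ((x + algebraMap R A a₃) * ((y + algebraMap R A a₂) *
        (x + algebraMap R A a₁))) := by
  have hx' (z : A) : x * (x * z) = T • (x * z) - q • z := by
    rw [← mul_assoc, hx, sub_mul, smul_mul_assoc, smul_mul_assoc, one_mul]
  have hy' (z : A) : y * (y * z) = T • (y * z) - q • z := by
    rw [← mul_assoc, hy, sub_mul, smul_mul_assoc, smul_mul_assoc, one_mul]
  simp only [Algebra.algebraMap_eq_smul_one, add_mul, mul_add, smul_mul_assoc, mul_smul_comm,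
    one_mul, mul_one, mul_sub, hx, hy, hx', hy', h]
  linear_combination (norm := module) ha • (x * y) - ha • (y * x)

set_option maxHeartbeats 1600000 in
lemma yangBaxter_six (hx : x * x = T • x - q • 1) (hy : y * y = T • y - q • 1)
    (h : x * (y * (x * (y * (x * y)))) = y * (x * (y * (x * (y * x))))) {a₁ a₂ a₃ a₄ a₅ a₆ : R}
    (ha : T * a₂ + T * a₃ + T * a₄ + T * a₅ + a₁ * a₂ - a₁ * a₆ + a₂ * a₃ + a₃ * a₄ + a₄ * a₅
      + a₅ * a₆ = 0)
    (hb : T * a₃ + T * a₄ + a₁ * a₃ - a₁ * a₅ + a₂ * a₄ - a₂ * a₆ + a₃ * a₅ + a₄ * a₆ = 0)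
    (hc : T * T * a₂ * a₄ + T * T * a₂ * a₅ + T * T * a₃ * a₅ + T * a₁ * a₂ * a₄
      + T * a₁ * a₂ * a₅ - T * a₁ * a₃ * a₆ - T * a₁ * a₄ * a₆ + T * a₂ * a₃ * a₄
      + T * a₂ * a₃ * a₅ + T * a₂ * a₄ * a₅ + T * a₂ * a₅ * a₆ + T * a₃ * a₄ * a₅
      + T * a₃ * a₅ * a₆ + a₁ * a₂ * a₃ * a₄ - a₁ * a₂ * a₃ * a₆ + a₁ * a₂ * a₄ * a₅
      + a₁ * a₂ * a₅ * a₆ - a₁ * a₃ * a₄ * a₆ - a₁ * a₄ * a₅ * a₆ + a₂ * a₃ * a₄ * a₅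
      + a₂ * a₃ * a₅ * a₆ + a₃ * a₄ * a₅ * a₆ = 0) :
    (x + algebraMap R A a₁) * ((y + algebraMap R A a₂) * ((x + algebraMap R A a₃) *
        ((y + algebraMap R A a₄) * ((x + algebraMap R A a₅) * (y + algebraMap R A a₆))))) =
      (y + algebraMap R A a₆) * ((x + algebraMap R A a₅) * ((y + algebraMap R A a₄) *
        ((x + algebraMap R A a₃) * ((y + algebraMap R A a₂) * (x + algebraMap R A a₁))))) := by
  have hx' (z : A) : x * (x * z) = T • (x * z) - q • z := by
    rw [← mul_assoc, hx, sub_mul, smul_mul_assoc, smul_mul_assoc, one_mul]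
  have hy' (z : A) : y * (y * z) = T • (y * z) - q • z := by
    rw [← mul_assoc, hy, sub_mul, smul_mul_assoc, smul_mul_assoc, one_mul]
  -- Each side is split into two halves of three factors, normalised before they are multiplied, to
  -- limit the number of terms.
  have key : ∀ {x y : A}, x * x = T • x - q • 1 → ∀ a b c : R,
      (x + algebraMap R A a) * ((y + algebraMap R A b) * (x + algebraMap R A c)) =
        x * (y * x) + c • (x * y) + a • (y * x) + (a * b + b * c + b * T) • x + (a * c) • y
          + (a * b * c - b * q) • 1 := by
    intro x y hx a b c
    simp only [Algebra.algebraMap_eq_smul_one, add_mul, mul_add, smul_mul_assoc, mul_smul_comm,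
      one_mul, mul_one, hx]
    module
  rw [← mul_assoc, ← mul_assoc, mul_assoc (x + algebraMap R A a₁), key hx, key hy,
    ← mul_assoc (y + algebraMap R A a₆), ← mul_assoc _ (y + algebraMap R A a₄),
    mul_assoc (y + algebraMap R A a₆), key hy, key hx]
  simp only [add_mul, mul_add, smul_mul_assoc, mul_smul_comm, mul_assoc,
    one_mul, mul_one, mul_sub, hx, hy, hx', hy', h, smul_sub]
  linear_combination (norm := module) ha • (x * (y * (x * y))) - ha • (y * (x * (y * x)))
    + (hc - q * hb) • (x * y) - (hc - q * hb) • (y * x)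

end RankTwoAlgebra

/-! ### Scalar identities behind the rank-two relations. -/

section RankTwoScalars

variable {K : Type*} [Field K] {X Y : K}

/-- Here `X = e^{-α}` and `Y = e^{-β}`, and the `a_k` are the values `1/E` at the successive
positive roots. The conditions of the algebraic lemmas are homogeneous in `T` and the parameters, so
`T` is scaled to 1. -/
lemma yangBaxter_scalar_three (hX : X - 1 ≠ 0) (hY : Y - 1 ≠ 0) (hXY : X * Y - 1 ≠ 0)
    {a₁ a₂ a₃ : K} (h₁ : a₁ = (X - 1)⁻¹) (h₂ : a₂ = (X * Y - 1)⁻¹) (h₃ : a₃ = (Y - 1)⁻¹) :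
    a₂ + a₁ * a₂ - a₁ * a₃ + a₂ * a₃ = 0 := by
  subst h₁ h₂ h₃
  field_simp
  ring

lemma yangBaxter_scalar_four (hX : X - 1 ≠ 0) (hY : Y - 1 ≠ 0) (hXY : X * Y - 1 ≠ 0)
    (hXXY : X ^ 2 * Y - 1 ≠ 0) {a₁ a₂ a₃ a₄ : K} (h₁ : a₁ = (X - 1)⁻¹)
    (h₂ : a₂ = (X ^ 2 * Y - 1)⁻¹) (h₃ : a₃ = (X * Y - 1)⁻¹) (h₄ : a₄ = (Y - 1)⁻¹) :
    a₂ + a₃ + a₁ * a₂ - a₁ * a₄ + a₂ * a₃ + a₃ * a₄ = 0 := by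
  subst h₁ h₂ h₃ h₄
  field_simp
  ring

lemma yangBaxter_scalar_six (hX : X - 1 ≠ 0) (hY : Y - 1 ≠ 0) (h31 : X ^ 3 * Y - 1 ≠ 0)
    (h21 : X ^ 2 * Y - 1 ≠ 0) (h32 : X ^ 3 * Y ^ 2 - 1 ≠ 0) (h11 : X * Y - 1 ≠ 0)
    {a₁ a₂ a₃ a₄ a₅ a₆ : K} (h₁ : a₁ = (X - 1)⁻¹)
    (h₂ : a₂ = (X ^ 3 * Y - 1)⁻¹) (h₃ : a₃ = (X ^ 2 * Y - 1)⁻¹) (h₄ : a₄ = (X ^ 3 * Y ^ 2 - 1)⁻¹)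
    (h₅ : a₅ = (X * Y - 1)⁻¹) (h₆ : a₆ = (Y - 1)⁻¹) :
    a₂ + a₃ + a₄ + a₅ + a₁ * a₂ - a₁ * a₆ + a₂ * a₃ + a₃ * a₄ + a₄ * a₅ + a₅ * a₆ = 0 ∧
    a₃ + a₄ + a₁ * a₃ - a₁ * a₅ + a₂ * a₄ - a₂ * a₆ + a₃ * a₅ + a₄ * a₆ = 0 ∧
    a₂ * a₄ + a₂ * a₅ + a₃ * a₅ + a₁ * a₂ * a₄
      + a₁ * a₂ * a₅ - a₁ * a₃ * a₆ - a₁ * a₄ * a₆ + a₂ * a₃ * a₄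
      + a₂ * a₃ * a₅ + a₂ * a₄ * a₅ + a₂ * a₅ * a₆ + a₃ * a₄ * a₅
      + a₃ * a₅ * a₆ + a₁ * a₂ * a₃ * a₄ - a₁ * a₂ * a₃ * a₆ + a₁ * a₂ * a₄ * a₅
      + a₁ * a₂ * a₅ * a₆ - a₁ * a₃ * a₄ * a₆ - a₁ * a₄ * a₅ * a₆ + a₂ * a₃ * a₄ * a₅
      + a₂ * a₃ * a₅ * a₆ + a₃ * a₄ * a₅ * a₆ = 0 := by
  subst h₁ h₂ h₃ h₄ h₅ h₆
  refine ⟨?_, ?_, ?_⟩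
  · field_simp
    ring
  · field_simp
    ring
  · field_simp
    ring

end RankTwoScalars

section Scalars

variable {M : Type*} [AddCommGroup M]

lemma expo_zero : expo (0 : M) = 1 := map_one _

lemma expo_add (μ ν : M) : expo (μ + ν) = expo μ * expo ν := by
  simp [expo, ← map_mul, AddMonoidAlgebra.single_mul_single]

lemma expo_nsmul (n : ℕ) (μ : M) : expo (n • μ) = expo μ ^ n := by
  induction n with
  | zero => simp [expo_zero]
  | succ n ih => rw [succ_nsmul, expo_add, ih, pow_succ]

lemma expo_injective : Function.Injective (expo : M → GroupAlgFrac M) :=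
  (IsFractionRing.injective (AddMonoidAlgebra ℤ M) (GroupAlgFrac M)).comp
    (AddMonoidAlgebra.single_left_injective one_ne_zero)

lemma E_ne_zero {μ : M} (hμ : μ ≠ 0) : E μ ≠ 0 := by
  rw [E, sub_ne_zero, ← expo_zero]
  exact expo_injective.ne (neg_ne_zero.2 hμ)

lemma E_nsmul_add_nsmul (m n : ℕ) (μ ν : M) :
    E (m • μ + n • ν) = expo (-μ) ^ m * expo (-ν) ^ n - 1 := by
  rw [E, neg_add, expo_add, ← smul_neg, ← smul_neg, expo_nsmul, expo_nsmul]

end Scalars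

/-! ### Orders of products of two simple reflections. -/

section RankTwoOrders

open RootPairing

variable {ι M N : Type*} [AddCommGroup M] [AddCommGroup N] {P : RootPairing ι ℤ M N}
  (b : P.Base)

lemma mul_simple_smul (u : P.weylGroup) (i : b.support) (x : M) :
    (u * simple b i) • x = u • x - (P.coroot' i x) • u • P.root i := by
  rw [mul_smul]
  change u • (P.reflection i x) = _
  rw [reflection_apply, smul_sub]
  congr 1
  exact map_zsmul (DistribSMul.toAddMonoidHom M u) _ _

lemma mul_simple_smul_root (u : P.weylGroup) (i j : b.support) :
    (u * simple b i) • P.root j = u • P.root j - (P.pairing j i) • u • P.root i :=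
  mul_simple_smul b u i _

lemma eq_one_of_forall_smul_eq {w : P.weylGroup} (h : ∀ x : M, w • x = x) : w = 1 := by
  apply Subtype.ext
  apply RootPairing.Equiv.weightHom_injective P
  ext x
  exact h x

lemma smul_smul_add_smul {G : Type*} [Group G] [DistribMulAction G M] {t : G} {α β : M}
    {e f g h : ℤ} (hα : t • α = e • α + f • β) (hβ : t • β = g • α + h • β) (k l : ℤ) :
    t • (k • α + l • β) = (k * e + l * g) • α + (k * f + l * h) • β := by
  have hz (k : ℤ) (x : M) : t • (k • x) = k • (t • x) :=
    map_zsmul (DistribSMul.toAddMonoidHom M t) _ _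
  rw [smul_add, hz, hz, hα, hβ]
  module

/-- The simple reflections `s_i`, `s_j` on the span of `α_i`, `α_j`. -/
lemma simple_mul_simple_smul_root {i j : b.support} {p r : ℤ}
    (hp : P.pairing j i = p) (hr : P.pairing i j = r) (k l : ℤ) :
    (simple b i * simple b j) • (k • P.root i + l • P.root j) =
      (k * (r * p - 1) + l * p) • P.root i + (k * (-r) + l * (-1)) • P.root j := by
  apply smul_smul_add_smul
  · rw [mul_simple_smul_root, ← one_mul (simple b i), mul_simple_smul_root, mul_simple_smul_root,
      one_smul, one_smul, pairing_same, hp, hr]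
    module
  · rw [mul_simple_smul_root, ← one_mul (simple b i), mul_simple_smul_root,
      one_smul, one_smul, pairing_same, hp]
    module

lemma simple_mul_simple_smul (i j : b.support) (x : M) :
    ∃ m n : ℤ, (simple b i * simple b j) • x = x + (m • P.root i + n • P.root j) := by
  refine ⟨-P.coroot' i x + P.coroot' j x * P.pairing j i, -P.coroot' j x, ?_⟩
  rw [mul_simple_smul, ← one_mul (simple b i), mul_simple_smul, mul_simple_smul_root, one_smul,
    one_smul, one_smul]
  module

lemma eq_and_eq_of_smul_root_add_smul_root {i j : b.support} (hij : i ≠ j) {k l k' l' : ℤ}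
    (h : k • P.root i + l • P.root j = k' • P.root i + l' • P.root j) : k = k' ∧ l = l' := by
  have h1 := LinearIndependent.pair_iff.1 (b.linearIndependent_pair_of_ne hij) (k - k') (l - l')
    (by rw [← sub_eq_zero] at h; rw [← h]; module)
  omega

/-- The Cartan integers give the matrix of `s_i s_j` on the plane of `α_i, α_j`. Smaller powers
already move `α_i`. -/
lemma orderOf_simple_mul_simple {i j : b.support} (hij : i ≠ j) {p r : ℤ}
    (hp : P.pairing j i = p) (hr : P.pairing i j = r) {m : ℕ}
    (h : (p = 0 ∧ r = 0 ∧ m = 2) ∨ (p = -1 ∧ r = -1 ∧ m = 3) ∨ (p = -2 ∧ r = -1 ∧ m = 4) ∨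
      (p = -3 ∧ r = -1 ∧ m = 6)) :
    orderOf (simple b i * simple b j) = m := by
  have key := simple_mul_simple_smul_root b hp hr
  have hone : P.root i = (1 : ℤ) • P.root i + (0 : ℤ) • P.root j := by module
  have hx := simple_mul_simple_smul b i j
  generalize simple b i * simple b j = t at key hx ⊢
  rw [orderOf_eq_iff (by omega)]
  constructor
  · apply eq_one_of_forall_smul_eq
    intro x
    -- The plane need not be all of `M`, so the displacement of an arbitrary `x`, which lies in the
    -- plane, is followed until it returns to zero.
    obtain ⟨m, n, hx⟩ := hx x
    have hx' (k l : ℤ) : t • (x + (k • P.root i + l • P.root j)) =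
        x + ((m + (k * (r * p - 1) + l * p)) • P.root i +
          (n + (k * (-r) + l * (-1))) • P.root j) := by
      rw [smul_add, hx, key]
      module
    rcases h with ⟨rfl, rfl, rfl⟩ | ⟨rfl, rfl, rfl⟩ | ⟨rfl, rfl, rfl⟩ | ⟨rfl, rfl, rfl⟩ <;>
    · simp only [pow_succ', pow_zero, mul_one, mul_smul t, hx, hx']
      module
  · intro k hk hk0 h1
    have h2 : t ^ k • P.root i = P.root i := by rw [h1, one_smul]
    rw [hone] at h2
    rcases h with ⟨rfl, rfl, rfl⟩ | ⟨rfl, rfl, rfl⟩ | ⟨rfl, rfl, rfl⟩ | ⟨rfl, rfl, rfl⟩ <;>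
    interval_cases k <;>
    · simp only [pow_succ', pow_zero, mul_one, mul_smul t, key] at h2
      have h3 := eq_and_eq_of_smul_root_add_smul_root b hij h2
      norm_num at h3

lemma smul_root_ne_zero (u : P.weylGroup) (k : ι) : u • P.root k ≠ 0 := by
  rw [← root_smul]
  exact P.ne_zero _

end RankTwoOrders

/-! ### Rank-two Yang–Baxter relations in the Hecke algebra. -/

section RankTwoHecke

open RootPairing

variable {ι M N : Type*} [AddCommGroup M] [AddCommGroup N] {P : RootPairing ι ℤ M N}
  (b : P.Base) [Module.Free ℤ M]

lemma ybProd_altWord_two {i j : b.support} (hij : i ≠ j) (hp : P.pairing j i = 0)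
    (hr : P.pairing i j = 0) (u : P.weylGroup) :
    ybProd b u (altWord 2 i j) = ybProd b u (altWord 2 j i) := by
  have hbr := altProd_gen_comm b i j hij
  rw [orderOf_simple_mul_simple b hij hp hr (m := 2) (by simp)] at hbr
  simp only [altProd, mul_one] at hbr
  simp only [altWord, ybProd, mul_one, mul_simple_smul_root, hp, hr, zero_smul, sub_zero]
  exact yangBaxter_two hbr _ _

/-- With `α = uα_i` and `β = uα_j`, one word meets `α, α+β, β` and the other meets the same roots in
reverse. The two other non-commuting types follow the same scheme with longer root strings. -/
lemma ybProd_altWord_three {i j : b.support} (hij : i ≠ j) (hp : P.pairing j i = -1)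
    (hr : P.pairing i j = -1) (u : P.weylGroup) :
    ybProd b u (altWord 3 i j) = ybProd b u (altWord 3 j i) := by
  have hbr := altProd_gen_comm b i j hij
  rw [orderOf_simple_mul_simple b hij hp hr (m := 3) (by simp)] at hbr
  simp only [altProd, mul_one] at hbr
  have hv2 : (u * simple b i) • P.root j = u • P.root i + u • P.root j := by
    simp only [mul_simple_smul_root, hp]
    generalize u • P.root i = α
    generalize u • P.root j = β
    module
  have hw2 : (u * simple b j) • P.root i = u • P.root i + u • P.root j := by
    simp only [mul_simple_smul_root, hr]
    generalize u • P.root i = α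
    generalize u • P.root j = β
    module
  have hv3 : (u * simple b i * simple b j) • P.root i = u • P.root j := by
    simp only [mul_simple_smul_root, hp, hr, pairing_same]
    generalize u • P.root i = α
    generalize u • P.root j = β
    module
  have hw3 : (u * simple b j * simple b i) • P.root j = u • P.root i := by
    simp only [mul_simple_smul_root, hp, hr, pairing_same]
    generalize u • P.root i = α
    generalize u • P.root j = β
    module
  have hX := E_ne_zero (smul_root_ne_zero u (i : ι))
  have hY := E_ne_zero (smul_root_ne_zero u (j : ι))
  have h11 := E_ne_zero (smul_root_ne_zero (u * simple b i) (j : ι))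
  simp only [altWord, ybProd, mul_one, hv2, hv3, hw2, hw3]
  rw [hv2] at h11
  clear hv2 hv3 hw2 hw3
  generalize u • P.root i = α at *
  generalize u • P.root j = β at *
  have e11 : E (α + β) = expo (-α) * expo (-β) - 1 := by
    simpa using E_nsmul_add_nsmul 1 1 α β
  have h := congrArg (MvPolynomial.C (σ := Fin 2)) (yangBaxter_scalar_three hX hY (e11 ▸ h11)
    (congrArg _ (rfl : E α = _)) (congrArg _ e11) (congrArg _ (rfl : E β = _)))
  simp only [map_add, map_sub, map_mul, map_zero] at h
  refine yangBaxter_three (gen_mul_self b i) (gen_mul_self b j) hbr ?_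
  simp only [ybCoeff]
  linear_combination (t₁ M + t₂ M) ^ 2 * h

lemma ybProd_altWord_four {i j : b.support} (hij : i ≠ j) (hp : P.pairing j i = -2)
    (hr : P.pairing i j = -1) (u : P.weylGroup) :
    ybProd b u (altWord 4 i j) = ybProd b u (altWord 4 j i) := by
  have hbr := altProd_gen_comm b i j hij
  rw [orderOf_simple_mul_simple b hij hp hr (m := 4) (by simp)] at hbr
  simp only [altProd, mul_one] at hbr
  have hv2 : (u * simple b i) • P.root j = 2 • u • P.root i + u • P.root j := by
    simp only [mul_simple_smul_root, hp]
    generalize u • P.root i = α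
    generalize u • P.root j = β
    module
  have hw2 : (u * simple b j) • P.root i = u • P.root i + u • P.root j := by
    simp only [mul_simple_smul_root, hr]
    generalize u • P.root i = α
    generalize u • P.root j = β
    module
  have hv3 : (u * simple b i * simple b j) • P.root i = u • P.root i + u • P.root j := by
    simp only [mul_simple_smul_root, hp, hr, pairing_same]
    generalize u • P.root i = α
    generalize u • P.root j = β
    module
  have hw3 : (u * simple b j * simple b i) • P.root j = 2 • u • P.root i + u • P.root j := by
    simp only [mul_simple_smul_root, hp, hr, pairing_same]
    generalize u • P.root i = α
    generalize u • P.root j = β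
    module
  have hv4 : (u * simple b i * simple b j * simple b i) • P.root j = u • P.root j := by
    simp only [mul_simple_smul_root, hp, hr, pairing_same]
    generalize u • P.root i = α
    generalize u • P.root j = β
    module
  have hw4 : (u * simple b j * simple b i * simple b j) • P.root i = u • P.root i := by
    simp only [mul_simple_smul_root, hp, hr, pairing_same]
    generalize u • P.root i = α
    generalize u • P.root j = β
    module
  have hX := E_ne_zero (smul_root_ne_zero u (i : ι))
  have hY := E_ne_zero (smul_root_ne_zero u (j : ι))
  have h21 := E_ne_zero (smul_root_ne_zero (u * simple b i) (j : ι))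
  have h11 := E_ne_zero (smul_root_ne_zero (u * simple b i * simple b j) (i : ι))
  simp only [altWord, ybProd, mul_one, hv2, hv3, hv4, hw2, hw3, hw4]
  rw [hv2] at h21
  rw [hv3] at h11
  clear hv2 hv3 hv4 hw2 hw3 hw4
  generalize u • P.root i = α at *
  generalize u • P.root j = β at *
  have e21 : E (2 • α + β) = expo (-α) ^ 2 * expo (-β) - 1 := by
    simpa using E_nsmul_add_nsmul 2 1 α β
  have e11 : E (α + β) = expo (-α) * expo (-β) - 1 := by
    simpa using E_nsmul_add_nsmul 1 1 α β
  have h := congrArg (MvPolynomial.C (σ := Fin 2)) (yangBaxter_scalar_four hX hY (e11 ▸ h11) (e21 ▸ h21)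
    (congrArg _ (rfl : E α = _)) (congrArg _ e21) (congrArg _ e11) (congrArg _ (rfl : E β = _)))
  simp only [map_add, map_sub, map_mul, map_zero] at h
  refine yangBaxter_four (gen_mul_self b i) (gen_mul_self b j) hbr ?_
  simp only [ybCoeff]
  linear_combination (t₁ M + t₂ M) ^ 2 * h

lemma ybProd_altWord_six {i j : b.support} (hij : i ≠ j) (hp : P.pairing j i = -3)
    (hr : P.pairing i j = -1) (u : P.weylGroup) :
    ybProd b u (altWord 6 i j) = ybProd b u (altWord 6 j i) := by
  have hbr := altProd_gen_comm b i j hij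
  rw [orderOf_simple_mul_simple b hij hp hr (m := 6) (by simp)] at hbr
  simp only [altProd, mul_one] at hbr
  have hv2 : (u * simple b i) • P.root j = 3 • u • P.root i + u • P.root j := by
    simp only [mul_simple_smul_root, hp]
    generalize u • P.root i = α
    generalize u • P.root j = β
    module
  have hw2 : (u * simple b j) • P.root i = u • P.root i + u • P.root j := by
    simp only [mul_simple_smul_root, hr]
    generalize u • P.root i = α
    generalize u • P.root j = β
    module
  have hv3 : (u * simple b i * simple b j) • P.root i = 2 • u • P.root i + u • P.root j := by
    simp only [mul_simple_smul_root, hp, hr, pairing_same]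
    generalize u • P.root i = α
    generalize u • P.root j = β
    module
  have hw3 : (u * simple b j * simple b i) • P.root j = 3 • u • P.root i + 2 • u • P.root j := by
    simp only [mul_simple_smul_root, hp, hr, pairing_same]
    generalize u • P.root i = α
    generalize u • P.root j = β
    module
  have hv4 : (u * simple b i * simple b j * simple b i) • P.root j = 3 • u • P.root i + 2 • u • P.root j := by
    simp only [mul_simple_smul_root, hp, hr, pairing_same]
    generalize u • P.root i = α
    generalize u • P.root j = β
    module
  have hw4 : (u * simple b j * simple b i * simple b j) • P.root i = 2 • u • P.root i + u • P.root j := by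
    simp only [mul_simple_smul_root, hp, hr, pairing_same]
    generalize u • P.root i = α
    generalize u • P.root j = β
    module
  have hv5 : (u * simple b i * simple b j * simple b i * simple b j) • P.root i = u • P.root i + u • P.root j := by
    simp only [mul_simple_smul_root, hp, hr, pairing_same]
    generalize u • P.root i = α
    generalize u • P.root j = β
    module
  have hw5 : (u * simple b j * simple b i * simple b j * simple b i) • P.root j = 3 • u • P.root i + u • P.root j := by
    simp only [mul_simple_smul_root, hp, hr, pairing_same]
    generalize u • P.root i = α
    generalize u • P.root j = β
    module
  have hv6 : (u * simple b i * simple b j * simple b i * simple b j * simple b i) • P.root j = u • P.root j := by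
    simp only [mul_simple_smul_root, hp, hr, pairing_same]
    generalize u • P.root i = α
    generalize u • P.root j = β
    module
  have hw6 : (u * simple b j * simple b i * simple b j * simple b i * simple b j) • P.root i = u • P.root i := by
    simp only [mul_simple_smul_root, hp, hr, pairing_same]
    generalize u • P.root i = α
    generalize u • P.root j = β
    module
  have hX := E_ne_zero (smul_root_ne_zero u (i : ι))
  have hY := E_ne_zero (smul_root_ne_zero u (j : ι))
  have h31 := E_ne_zero (smul_root_ne_zero (u * simple b i) (j : ι))
  have h21 := E_ne_zero (smul_root_ne_zero (u * simple b i * simple b j) (i : ι))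
  have h32 := E_ne_zero (smul_root_ne_zero (u * simple b i * simple b j * simple b i) (j : ι))
  have h11 := E_ne_zero (smul_root_ne_zero (u * simple b i * simple b j * simple b i * simple b j) (i : ι))
  simp only [altWord, ybProd, mul_one, hv2, hv3, hv4, hv5, hv6, hw2, hw3, hw4, hw5, hw6]
  rw [hv2] at h31
  rw [hv3] at h21
  rw [hv4] at h32
  rw [hv5] at h11
  clear hv2 hv3 hv4 hv5 hv6 hw2 hw3 hw4 hw5 hw6
  generalize u • P.root i = α at *
  generalize u • P.root j = β at *
  have e31 : E (3 • α + β) = expo (-α) ^ 3 * expo (-β) - 1 := by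
    simpa using E_nsmul_add_nsmul 3 1 α β
  have e21 : E (2 • α + β) = expo (-α) ^ 2 * expo (-β) - 1 := by
    simpa using E_nsmul_add_nsmul 2 1 α β
  have e32 : E (3 • α + 2 • β) = expo (-α) ^ 3 * expo (-β) ^ 2 - 1 := by
    simpa using E_nsmul_add_nsmul 3 2 α β
  have e11 : E (α + β) = expo (-α) * expo (-β) - 1 := by
    simpa using E_nsmul_add_nsmul 1 1 α β
  obtain ⟨ha, hb, hc⟩ := yangBaxter_scalar_six hX hY (e31 ▸ h31) (e21 ▸ h21) (e32 ▸ h32) (e11 ▸ h11)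
    (congrArg _ (rfl : E α = _)) (congrArg _ e31) (congrArg _ e21) (congrArg _ e32) (congrArg _ e11) (congrArg _ (rfl : E β = _))
  replace ha := congrArg (MvPolynomial.C (σ := Fin 2)) ha
  replace hb := congrArg (MvPolynomial.C (σ := Fin 2)) hb
  replace hc := congrArg (MvPolynomial.C (σ := Fin 2)) hc
  simp only [map_add, map_sub, map_mul, map_zero] at ha hb hc
  refine yangBaxter_six (gen_mul_self b i) (gen_mul_self b j) hbr ?_ ?_ ?_
  all_goals simp only [ybCoeff]
  · linear_combination (t₁ M + t₂ M) ^ 2 * ha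
  · linear_combination (t₁ M + t₂ M) ^ 2 * hb
  · linear_combination (t₁ M + t₂ M) ^ 4 * hc

end RankTwoHecke

/-! ### Yang–Baxter elements -/

section YangBaxterElements

open RootPairing

variable {ι M N : Type*} [AddCommGroup M] [AddCommGroup N] {P : RootPairing ι ℤ M N}
  (b : P.Base) [Module.Free ℤ M]

lemma ybProd_append (u : P.weylGroup) (l l' : List b.support) :
    ybProd b u (l ++ l') = ybProd b u l * ybProd b (u * wordProd b l) l' := by
  induction l generalizing u with
  | nil => simp [ybProd]
  | cons i l ih => rw [List.cons_append, ybProd, ybProd, ih, wordProd_cons, mul_assoc, mul_assoc]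

/-- From `(E(-μ)+1)(E(μ)+1) = e^μ e^{-μ} = 1`, the reciprocals of `E(μ)` and `E(-μ)` add up to `-1`.
-/
lemma ybCoeff_neg_add {μ : M} (hμ : μ ≠ 0) : ybCoeff (-μ) + ybCoeff μ = -(t₁ M + t₂ M) := by
  have h1 := E_ne_zero hμ
  have h2 := E_ne_zero (neg_ne_zero.2 hμ)
  have h3 : (E (-μ) + 1) * (E μ + 1) = 1 := by
    rw [E, E, sub_add_cancel, sub_add_cancel, ← expo_add, neg_add_cancel, expo_zero]
  have h4 : (E (-μ))⁻¹ + (E μ)⁻¹ = -1 := by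
    field_simp
    linear_combination h3
  rw [ybCoeff, ybCoeff, ← mul_add, ← map_add, h4, map_neg, map_one]
  ring

variable [Finite ι] [P.IsReduced]

lemma ybProd_altWord {i j : b.support} (hij : i ≠ j) (u : P.weylGroup) :
    ybProd b u (altWord (orderOf (simple b i * simple b j)) i j) =
      ybProd b u (altWord (orderOf (simple b i * simple b j)) j i) := by
  have hij' : (i : ι) ≠ j := fun h ↦ hij (Subtype.ext h)
  -- Only finitely many pairs of Cartan integers are possible. Distinct simple roots pair
  -- non-positively, which removes the positive pairs, and the asymmetric types occur in both
  -- orders.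
  have h := P.pairingIn_pairingIn_mem_set_of_isCrystal_of_isRed' i j
    (P.root.injective.ne hij') (b.root_ne_neg_of_ne i.2 j.2 hij')
  have h1 := b.pairingIn_le_zero_of_ne hij' i.2 j.2
  have h2 (k l : ι) : P.pairingIn ℤ k l = P.pairing k l := P.algebraMap_pairingIn ℤ k l
  rw [h2] at h1
  simp only [h2, Set.mem_insert_iff, Set.mem_singleton_iff, Prod.mk.injEq] at h
  rcases h with h | h | h | h | h | h | h | h | h | h | h
  · rw [orderOf_simple_mul_simple b hij h.2 h.1 (m := 2) (by simp)]
    exact ybProd_altWord_two b hij h.2 h.1 u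
  · omega
  · rw [orderOf_simple_mul_simple b hij h.2 h.1 (m := 3) (by simp)]
    exact ybProd_altWord_three b hij h.2 h.1 u
  · omega
  · omega
  · rw [orderOf_simple_mul_simple b hij h.2 h.1 (m := 4) (by simp)]
    exact ybProd_altWord_four b hij h.2 h.1 u
  · rw [← orderOf_simple_mul_comm, orderOf_simple_mul_simple b hij.symm h.1 h.2 (m := 4) (by simp)]
    exact (ybProd_altWord_four b hij.symm h.1 h.2 u).symm
  · omega
  · omega
  · rw [orderOf_simple_mul_simple b hij h.2 h.1 (m := 6) (by simp)]
    exact ybProd_altWord_six b hij h.2 h.1 u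
  · rw [← orderOf_simple_mul_comm, orderOf_simple_mul_simple b hij.symm h.1 h.2 (m := 6) (by simp)]
    exact (ybProd_altWord_six b hij.symm h.1 h.2 u).symm

lemma ybProd_eq_of_isReducedWord (u : P.weylGroup) {l l' : List b.support}
    (hl : IsReducedWord b l) (hl' : IsReducedWord b l') (h : wordProd b l = wordProd b l') :
    ybProd b u l = ybProd b u l' := by
  -- The relation quantifies over `u` because prepending a letter `i` replaces `u` by `u s_i` in the
  -- tail.
  refine matsumoto b (r := fun l l' ↦ ∀ u, ybProd b u l = ybProd b u l')
    ⟨fun _ _ ↦ rfl, fun h u ↦ (h u).symm, fun h h' u ↦ (h u).trans (h' u)⟩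
    (fun i l l' h u ↦ ?_) (fun i j hij l u ↦ ?_) hl hl' h u
  · rw [ybProd, ybProd, h]
  · rw [ybProd_append, ybProd_append, ybProd_altWord b hij, wordProd_altWord_comm]

lemma ybElt_wordProd {l : List b.support} (hl : IsReducedWord b l) :
    ybElt b (wordProd b l) = ybProd b 1 l :=
  ybProd_eq_of_isReducedWord b 1 (isReducedWord_reducedWord b _) hl (wordProd_reducedWord b _)

lemma ybElt_one : ybElt b 1 = 1 := by
  have h := ybElt_wordProd b (l := []) (by rw [isReducedWord_iff]; simp)
  simpa [ybProd] using h

lemma ybElt_mul_simple {w : P.weylGroup} {i : b.support} (h : b.IsPos (w • (i : ι))) :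
    ybElt b (w * simple b i) = ybElt b w *
      (gen b i + algebraMap (Coeff M) (Hecke b) (ybCoeff (w • P.root i))) := by
  have := ybElt_wordProd b (isReducedWord_concat b h)
  rw [wordProd_append, wordProd_reducedWord, wordProd_cons, wordProd_nil, mul_one] at this
  rw [this, ybProd_append, wordProd_reducedWord, one_mul, ybProd, ybProd, mul_one, ybElt]

lemma add_algebraMap_mul_add_algebraMap {R A : Type*} [CommRing R] [Ring A] [Algebra R A]
    {h : A} {T q a a' : R} (hh : h * h = T • h - q • 1) (ha : a' + a = -T) :
    (h + algebraMap R A a') * (h + algebraMap R A a) = (a' * a - q) • 1 := by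
  simp only [Algebra.algebraMap_eq_smul_one, add_mul, mul_add, smul_mul_assoc, mul_smul_comm,
    one_mul, mul_one, hh]
  linear_combination (norm := module) ha • h

/-- `Y_w` ends in the factor for `-wα_i`. Its parameter and that of the new factor sum to
`-(t₁+t₂)`, so the quadratic relation reduces their product to a scalar. Orthogonality does not need
its value. -/
lemma exists_ybElt_mul_eq_smul {w : P.weylGroup} {i : b.support} (h : ¬ b.IsPos (w • (i : ι))) :
    ∃ c : Coeff M, ybElt b w *
      (gen b i + algebraMap (Coeff M) (Hecke b) (ybCoeff (w • P.root i))) =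
        c • ybElt b (w * simple b i) := by
  have h1 := ybElt_mul_simple b (w := w * simple b i) (i := i)
    (by rwa [isPos_mul_simple_smul_iff])
  rw [mul_simple_cancel_right, mul_simple_smul_root, pairing_same,
    show w • P.root (i : ι) - (2 : ℤ) • w • P.root (i : ι) = -(w • P.root (i : ι)) by
      generalize w • P.root (i : ι) = α
      module] at h1
  refine ⟨ybCoeff (-(w • P.root i)) * ybCoeff (w • P.root i) - t₁ M * t₂ M, ?_⟩
  rw [h1, mul_assoc, add_algebraMap_mul_add_algebraMap (gen_mul_self b i)
    (ybCoeff_neg_add (smul_root_ne_zero w i)), mul_smul_comm, mul_one]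

end YangBaxterElements

/-! ### Leading terms of Yang–Baxter elements. -/

section Triangularity

variable {ι M N : Type*} [AddCommGroup M] [AddCommGroup N] {P : RootPairing ι ℤ M N}
  (b : P.Base) [Finite ι] [P.IsReduced]

/-- The span of the `h_w` with `ℓ(w) < n`. -/
noncomputable def lengthFiltration (n : ℕ) : Submodule (Coeff M) (Hecke b) :=
  Submodule.span (Coeff M) (heckeElt b '' {w | length b w < n})

lemma heckeElt_mem_lengthFiltration {w : P.weylGroup} {n : ℕ} (h : length b w < n) :
    heckeElt b w ∈ lengthFiltration b n :=
  Submodule.subset_span ⟨w, h, rfl⟩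

lemma lengthFiltration_mono {m n : ℕ} (h : m ≤ n) :
    lengthFiltration b m ≤ lengthFiltration b n :=
  Submodule.span_mono (Set.image_mono fun _ hw ↦ lt_of_lt_of_le hw h)

lemma gen_mul_mem_lengthFiltration (i : b.support) {n : ℕ} {g : Hecke b}
    (hg : g ∈ lengthFiltration b n) : gen b i * g ∈ lengthFiltration b (n + 1) := by
  induction hg using Submodule.span_induction with
  | mem x hx =>
    obtain ⟨w, hw, rfl⟩ := hx
    have hw' : length b w < n := hw
    have h1 := length_simple_mul_le b i w
    by_cases h : b.IsPos (w⁻¹ • (i : ι))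
    · rw [gen_mul_heckeElt_of_isPos b h]
      exact heckeElt_mem_lengthFiltration b (by omega)
    · rw [gen_mul_heckeElt_of_not_isPos b h]
      exact sub_mem (Submodule.smul_mem _ _ (heckeElt_mem_lengthFiltration b (by omega)))
        (Submodule.smul_mem _ _ (heckeElt_mem_lengthFiltration b (by omega)))
  | zero => rw [mul_zero]; exact zero_mem _
  | add x y _ _ hx hy => rw [mul_add]; exact add_mem hx hy
  | smul c x _ hx => rw [mul_smul_comm]; exact Submodule.smul_mem _ _ hx

lemma prod_gen_mem_lengthFiltration (l : List b.support) :
    (l.map (gen b)).prod ∈ lengthFiltration b (l.length + 1) := by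
  induction l with
  | nil =>
    rw [List.map_nil, List.prod_nil, ← heckeElt_one b]
    exact heckeElt_mem_lengthFiltration b (by simp)
  | cons i l ih =>
    rw [List.map_cons, List.prod_cons]
    exact gen_mul_mem_lengthFiltration b i ih

lemma repr_eq_zero_of_mem_lengthFiltration {n : ℕ} {g : Hecke b}
    (hg : g ∈ lengthFiltration b n) {w : P.weylGroup} (hw : n ≤ length b w) :
    (heckeBasis b).repr g w = 0 := by
  induction hg using Submodule.span_induction with
  | mem x hx =>
    obtain ⟨v, hv, rfl⟩ := hx
    have hv' : length b v < n := hv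
    rw [← heckeBasis_apply, Module.Basis.repr_self,
      Finsupp.single_eq_of_ne (by rintro rfl; omega)]
  | zero => simp
  | add x y _ _ hx hy => simp [hx, hy]
  | smul c x _ hx => simp [hx]

variable [Module.Free ℤ M]

/-- Choosing the scalar in any factor leaves a product of fewer generators, which involves only
shorter elements. -/
lemma ybProd_sub_mem_lengthFiltration (u : P.weylGroup) (l : List b.support) :
    ybProd b u l - (l.map (gen b)).prod ∈ lengthFiltration b l.length := by
  induction l generalizing u with
  | nil =>
    rw [ybProd, List.map_nil, List.prod_nil, sub_self]
    exact zero_mem _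
  | cons i l ih =>
    have h1 := ih (u * simple b i)
    have h2 : ybProd b (u * simple b i) l ∈ lengthFiltration b (l.length + 1) := by
      rw [← sub_add_cancel (ybProd b (u * simple b i) l) (l.map (gen b)).prod]
      exact add_mem (lengthFiltration_mono b (Nat.le_succ _) h1)
        (prod_gen_mem_lengthFiltration b l)
    rw [ybProd, List.map_cons, List.prod_cons, add_mul, add_sub_right_comm, ← mul_sub,
      ← Algebra.smul_def]
    exact add_mem (gen_mul_mem_lengthFiltration b i h1) (Submodule.smul_mem _ _ h2)

lemma repr_ybElt_of_isLongest [DecidableEq P.weylGroup] {w₀ : P.weylGroup}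
    (h₀ : IsLongest b w₀) (w : P.weylGroup) :
    (heckeBasis b).repr (ybElt b w) w₀ = if w = w₀ then 1 else 0 := by
  have h1 := repr_eq_zero_of_mem_lengthFiltration b
    (ybProd_sub_mem_lengthFiltration b 1 (reducedWord b w)) (h₀ w)
  change (heckeBasis b).repr (ybElt b w - heckeElt b w) w₀ = 0 at h1
  rw [map_sub, Finsupp.sub_apply, sub_eq_zero, ← heckeBasis_apply, Module.Basis.repr_self,
    Finsupp.single_apply] at h1
  exact h1

end Triangularity

/-! ### The longest element -/

section Longest

open RootPairing

variable {ι M N : Type*} [AddCommGroup M] [AddCommGroup N] {P : RootPairing ι ℤ M N}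
  {b : P.Base} [Finite ι] [P.IsReduced] {w₀ : P.weylGroup}

/-- Maximality makes every simple root a descent of `w₀`. Positive roots are built by adding simple
roots, and heights are additive. -/
lemma IsLongest.not_isPos_smul (h₀ : IsLongest b w₀) {k : ι} (hk : b.IsPos k) :
    ¬ b.IsPos (w₀ • k) := by
  refine RootPairing.Base.IsPos.induction_on_add (p := fun k ↦ ¬ b.IsPos (w₀ • k)) hk
    (fun i hi ↦ ?_) (fun i j k h hi hj ↦ ?_)
  · rw [← length_lt_mul_simple_iff b w₀ ⟨i, hi⟩, not_lt]
    exact h₀ _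
  · have hj' : ¬ b.IsPos (w₀ • j) := by
      rw [← length_lt_mul_simple_iff b w₀ ⟨j, hj⟩, not_lt]
      exact h₀ _
    have h1 := b.height_add (i := w₀ • i) (j := w₀ • j) (k := w₀ • k)
      (by rw [root_smul, root_smul, root_smul, h, smul_add])
    rw [RootPairing.Base.isPos_iff] at hi hj' ⊢
    omega

lemma IsLongest.isPos_smul_iff (h₀ : IsLongest b w₀) (k : ι) :
    b.IsPos (w₀ • k) ↔ ¬ b.IsPos k := by
  refine ⟨fun h hk ↦ h₀.not_isPos_smul hk h, fun h ↦ ?_⟩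
  rw [← isPos_reflectionPerm_self_iff] at h
  have h1 := h₀.not_isPos_smul h
  rwa [isPos_smul_reflectionPerm_self_iff, not_not] at h1

lemma IsLongest.inv (h₀ : IsLongest b w₀) : IsLongest b w₀⁻¹ := fun w ↦ by
  rw [length_inv]; exact h₀ w

lemma IsLongest.eq {w₀' : P.weylGroup} (h₀ : IsLongest b w₀) (h₀' : IsLongest b w₀') :
    w₀ = w₀' := by
  symm
  rw [← inv_mul_eq_one]
  refine eq_one_of_forall_isPos_smul b _ fun i ↦ ?_
  rw [mul_smul, h₀'.inv.isPos_smul_iff, h₀.isPos_smul_iff, not_not]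
  exact isPos_simple b i

lemma IsLongest.inv_eq (h₀ : IsLongest b w₀) : w₀⁻¹ = w₀ := h₀.inv.eq h₀

lemma IsLongest.mul_self (h₀ : IsLongest b w₀) : w₀ * w₀ = 1 := 
  mul_eq_one_iff_inv_eq.2 h₀.inv_eq

variable (b) in
lemma existsUnique_isLongest : ∃! w₀ : P.weylGroup, IsLongest b w₀ := by
  have := finite_weylGroup b
  obtain ⟨w₀, h₀⟩ := Finite.exists_max (length b)
  exact ⟨w₀, h₀, fun w h ↦ h.eq h₀⟩

end Longest

/-! ### The bilinear form -/

section CoeffAut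

variable {M : Type*} [AddCommGroup M] (g : M ≃+ M)

lemma fracAut_expo (μ : M) : fracAut g (expo μ) = expo (g μ) := by
  rw [fracAut, expo, IsFractionRing.ringEquivOfRingEquiv_algebraMap, expo]
  congr 1
  simp

lemma fracAut_E (μ : M) : fracAut g (E μ) = E (g μ) := by
  rw [E, map_sub, map_one, fracAut_expo, map_neg, E]

@[simp] lemma coeffAut_t₁ : coeffAut g (t₁ M) = t₁ M := MvPolynomial.map_X _ _

@[simp] lemma coeffAut_t₂ : coeffAut g (t₂ M) = t₂ M := MvPolynomial.map_X _ _

lemma coeffAut_ybCoeff [Module.Free ℤ M] (μ : M) : coeffAut g (ybCoeff μ) = ybCoeff (g μ) := by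
  rw [ybCoeff, map_mul, map_add, coeffAut_t₁, coeffAut_t₂, coeffAut, MvPolynomial.map_C,
    RingHom.coe_coe, map_inv₀, fracAut_E, ybCoeff]

end CoeffAut

section Form

open RootPairing

variable {ι M N : Type*} [AddCommGroup M] [AddCommGroup N] {P : RootPairing ι ℤ M N}
  {b : P.Base}

section Basis

variable (B : Module.Basis P.weylGroup (Coeff M) (Hecke b))

/-- The operation `vee` as a linear map. -/
noncomputable def veeHom : Hecke b →ₗ[Coeff M] Hecke b :=
  (Finsupp.linearCombination (Coeff M) fun w ↦ B w⁻¹) ∘ₗ B.repr.toLinearMap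

lemma vee_eq_veeHom (g : Hecke b) : vee B g = veeHom B g := rfl

@[simp] lemma veeHom_basis (w : P.weylGroup) : veeHom B (B w) = B w⁻¹ := by
  simp [veeHom]

lemma repr_vee (g : Hecke b) (w : P.weylGroup) : B.repr (vee B g) w = B.repr g w⁻¹ := by
  rw [vee_eq_veeHom]
  suffices h : Finsupp.lapply w ∘ₗ B.repr.toLinearMap ∘ₗ veeHom B =
      Finsupp.lapply w⁻¹ ∘ₗ B.repr.toLinearMap from LinearMap.congr_fun h g
  classical
  refine B.ext fun v ↦ ?_
  simp [Finsupp.single_apply, inv_eq_iff_eq_inv]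

lemma form_smul_right (w₀ : P.weylGroup) (f g : Hecke b) (c : Coeff M) :
    form B w₀ f (c • g) = c * form B w₀ f g := by
  simp [form, vee_eq_veeHom]

lemma form_add_right (w₀ : P.weylGroup) (f g g' : Hecke b) :
    form B w₀ f (g + g') = form B w₀ f g + form B w₀ f g' := by
  simp [form, vee_eq_veeHom, mul_add]

lemma repr_coeffAct (u : P.weylGroup) (g : Hecke b) (w : P.weylGroup) :
    B.repr (coeffAct B u g) w = coeffAut (DistribMulAction.toAddEquiv M u) (B.repr g w) := by
  have h : coeffAct B u g = B.repr.symm (Finsupp.mapRange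
      (coeffAut (DistribMulAction.toAddEquiv M u)) (map_zero _) (B.repr g)) := by
    rw [Module.Basis.repr_symm_apply, Finsupp.linearCombination_apply,
      Finsupp.sum_mapRange_index (by simp), coeffAct]
  rw [h, LinearEquiv.apply_symm_apply, Finsupp.mapRange_apply]

lemma coeffAct_add (u : P.weylGroup) (f g : Hecke b) :
    coeffAct B u (f + g) = coeffAct B u f + coeffAct B u g :=
  B.ext_elem fun w ↦ by simp [repr_coeffAct]

lemma coeffAct_sub (u : P.weylGroup) (f g : Hecke b) :
    coeffAct B u (f - g) = coeffAct B u f - coeffAct B u g :=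
  B.ext_elem fun w ↦ by simp [repr_coeffAct]

lemma coeffAct_smul (u : P.weylGroup) (c : Coeff M) (g : Hecke b) :
    coeffAct B u (c • g) =
      coeffAut (DistribMulAction.toAddEquiv M u) c • coeffAct B u g :=
  B.ext_elem fun w ↦ by simp [repr_coeffAct]

lemma coeffAct_basis (u w : P.weylGroup) : coeffAct B u (B w) = B w := by
  classical
  refine B.ext_elem fun v ↦ ?_
  rw [repr_coeffAct, Module.Basis.repr_self, Finsupp.single_apply]
  split_ifs <;> simp

end Basis

variable [Finite ι] [P.IsReduced]

/-- Inversion on `W` exchanges the left and right multiplication rules of the basis. This case of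
anti-multiplicativity is all that the form needs. -/
lemma vee_mul_gen (g : Hecke b) (i : b.support) :
    vee (heckeBasis b) (g * gen b i) = gen b i * vee (heckeBasis b) g := by
  rw [vee_eq_veeHom, vee_eq_veeHom]
  suffices h : veeHom (heckeBasis b) ∘ₗ LinearMap.mulRight (Coeff M) (gen b i) =
      LinearMap.mulLeft (Coeff M) (gen b i) ∘ₗ veeHom (heckeBasis b) from LinearMap.congr_fun h g
  refine (heckeBasis b).ext fun w ↦ ?_
  rw [LinearMap.comp_apply, LinearMap.comp_apply, LinearMap.mulRight_apply,
    LinearMap.mulLeft_apply, veeHom_basis, heckeBasis_apply, heckeBasis_apply]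
  by_cases h : b.IsPos (w • (i : ι))
  · rw [heckeElt_mul_gen_of_isPos b h, gen_mul_heckeElt_of_isPos b (by rwa [inv_inv]),
      ← heckeBasis_apply, veeHom_basis, mul_inv_rev, simple_inv, heckeBasis_apply]
  · rw [heckeElt_mul_gen_of_not_isPos b h, gen_mul_heckeElt_of_not_isPos b (by rwa [inv_inv]),
      map_sub, map_smul, map_smul, ← heckeBasis_apply, ← heckeBasis_apply, veeHom_basis,
      veeHom_basis, mul_inv_rev, simple_inv, heckeBasis_apply, heckeBasis_apply]

lemma form_mul_gen_add (w₀ : P.weylGroup) (f g : Hecke b) (i : b.support) (a : Coeff M) :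
    form (heckeBasis b) w₀ (f * (gen b i + algebraMap (Coeff M) (Hecke b) a)) g =
      form (heckeBasis b) w₀ f (g * (gen b i + algebraMap (Coeff M) (Hecke b) a)) := by
  have h : vee (heckeBasis b) (g * (gen b i + algebraMap (Coeff M) (Hecke b) a)) =
      (gen b i + algebraMap (Coeff M) (Hecke b) a) * vee (heckeBasis b) g := by
    rw [mul_add, add_mul, ← vee_mul_gen, ← Algebra.commutes, ← Algebra.smul_def,
      ← Algebra.smul_def]
    simp only [vee_eq_veeHom, map_add, map_smul]
  rw [form, form, h, mul_assoc]

/-- The structure constants for right multiplication by `h_i` are integer polynomials in `t₁, t₂`,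
which `W` fixes. -/
lemma coeffAct_mul_gen (u : P.weylGroup) (g : Hecke b) (i : b.support) :
    coeffAct (heckeBasis b) u (g * gen b i) = coeffAct (heckeBasis b) u g * gen b i := by
  have hg : g ∈ Submodule.span (Coeff M) (Set.range (heckeElt b : _ → Hecke b)) :=
    span_heckeElt b trivial
  have hB (w : P.weylGroup) : coeffAct (heckeBasis b) u (heckeElt b w) = heckeElt b w := by
    rw [← heckeBasis_apply, coeffAct_basis]
  induction hg using Submodule.span_induction with
  | mem x hx =>
    obtain ⟨w, rfl⟩ := hx
    by_cases h : b.IsPos (w • (i : ι))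
    · rw [hB, heckeElt_mul_gen_of_isPos b h, hB]
    · rw [hB, heckeElt_mul_gen_of_not_isPos b h, coeffAct_sub, coeffAct_smul, coeffAct_smul, hB, hB]
      simp
  | zero =>
    have h0 : coeffAct (heckeBasis b) u 0 = 0 := (heckeBasis b).ext_elem fun w ↦ by
      simp [repr_coeffAct]
    rw [zero_mul, h0, zero_mul]
  | add x y _ _ hx hy => rw [add_mul, coeffAct_add, hx, hy, coeffAct_add, add_mul]
  | smul c x _ hx => rw [smul_mul_assoc, coeffAct_smul, hx, coeffAct_smul, smul_mul_assoc]

variable [Module.Free ℤ M]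

lemma coeffAct_mul_gen_add (u : P.weylGroup) (g : Hecke b) (i : b.support) (μ : M) :
    coeffAct (heckeBasis b) u (g * (gen b i + algebraMap (Coeff M) (Hecke b) (ybCoeff μ))) =
      coeffAct (heckeBasis b) u g *
        (gen b i + algebraMap (Coeff M) (Hecke b) (ybCoeff (u • μ))) := by
  rw [mul_add, mul_add, coeffAct_add, coeffAct_mul_gen, ← Algebra.commutes, ← Algebra.commutes,
    ← Algebra.smul_def, ← Algebra.smul_def, coeffAct_smul, coeffAut_ybCoeff]
  rfl

variable {w₀ : P.weylGroup}

/-- A descent of `w` at `i` is an ascent of `w₀w`, and acting by `w₀` on coefficients turns the root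
`w₀wα_i` back into `wα_i`. -/
lemma coeffAct_ybElt_mul_simple (h₀ : IsLongest b w₀) {w : P.weylGroup} {i : b.support}
    (h : ¬ b.IsPos (w • (i : ι))) :
    coeffAct (heckeBasis b) w₀ (ybElt b (w₀ * w)) *
        (gen b i + algebraMap (Coeff M) (Hecke b) (ybCoeff (w • P.root i))) =
      coeffAct (heckeBasis b) w₀ (ybElt b (w₀ * (w * simple b i))) := by
  rw [← mul_assoc, ybElt_mul_simple b (w := w₀ * w) (by rwa [mul_smul, h₀.isPos_smul_iff]),
    coeffAct_mul_gen_add, ← mul_smul, ← mul_assoc, h₀.mul_self, one_mul]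

lemma exists_coeffAct_ybElt_mul_eq_smul (h₀ : IsLongest b w₀) {w : P.weylGroup} {i : b.support}
    (h : b.IsPos (w • (i : ι))) :
    ∃ c : Coeff M, coeffAct (heckeBasis b) w₀ (ybElt b (w₀ * w)) *
        (gen b i + algebraMap (Coeff M) (Hecke b) (ybCoeff (w • P.root i))) =
      c • coeffAct (heckeBasis b) w₀ (ybElt b (w₀ * (w * simple b i))) := by
  obtain ⟨c, hc⟩ := exists_ybElt_mul_eq_smul b (w := w₀ * w) (i := i)
    (by rw [mul_smul, h₀.isPos_smul_iff]; exact not_not.2 h)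
  have h1 := congrArg (coeffAct (heckeBasis b) w₀) hc
  rw [coeffAct_mul_gen_add, coeffAct_smul, ← mul_smul, ← mul_assoc w₀, h₀.mul_self, one_mul,
    mul_assoc] at h1
  exact ⟨_, h1⟩

lemma mul_add_algebraMap_eq {R A : Type*} [CommRing R] [Ring A] [Algebra R A] (g h : A)
    (a a' : R) :
    g * (h + algebraMap R A a) = g * (h + algebraMap R A a') + (a - a') • g := by
  simp only [Algebra.algebraMap_eq_smul_one, mul_add, mul_smul_comm, mul_one]
  module

/-- The Yang–Baxter elements `Y_v` and `w₀ (Y_{w₀ w})` are dual bases. -/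
theorem form_ybElt_coeffAct_ybElt [DecidableEq P.weylGroup] (h₀ : IsLongest b w₀)
    (v w : P.weylGroup) :
    form (heckeBasis b) w₀ (ybElt b v) (coeffAct (heckeBasis b) w₀ (ybElt b (w₀ * w))) =
      if v = w then 1 else 0 := by
  induction hn : length b v generalizing v w with
  | zero =>
    have hv : v = 1 := by
      rw [← wordProd_reducedWord b v, List.length_eq_zero_iff.1 hn, wordProd_nil]
    -- With first argument 1 the form is the coefficient at `w₀⁻¹ = w₀`, which is 1 exactly when
    -- `w₀w = w₀`.
    rw [hv, ybElt_one, form, one_mul, repr_vee, repr_coeffAct, h₀.inv_eq,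
      repr_ybElt_of_isLongest b h₀]
    simp only [mul_eq_left, eq_comm (a := (1 : P.weylGroup))]
    split_ifs <;> simp
  | succ n ih =>
    obtain ⟨i, hi⟩ : ∃ i : b.support, ¬ b.IsPos (v • (i : ι)) := by
      by_contra! h
      rw [eq_one_of_forall_isPos_smul b v h, length_one] at hn
      omega
    have hlen := length_mul_simple_of_not_isPos b v i hi
    have ih' (w : P.weylGroup) := ih (v * simple b i) w (by omega)
    have hv := ybElt_mul_simple b (w := v * simple b i) (i := i)
      (by rwa [isPos_mul_simple_smul_iff])
    rw [mul_simple_cancel_right] at hv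
    set a := ybCoeff ((v * simple b i) • P.root i)
    set a' := ybCoeff (w • P.root i) with ha'
    -- Replacing `a` by `a'` costs `(a - a')(Y_{vs_i}, G_w)`. By induction this can be nonzero only
    -- for `w = vs_i`, where the two coefficients coincide.
    have hdiff : (a - a') * (if v * simple b i = w then (1 : Coeff M) else 0) = 0 := by
      split_ifs with h
      · rw [ha', ← h, sub_self, zero_mul]
      · rw [mul_zero]
    have hiff : v * simple b i = w * simple b i ↔ v = w := mul_left_inj _
    set G := coeffAct (heckeBasis b) w₀ (ybElt b (w₀ * w)) with hG
    have hsplit : G * (gen b i + algebraMap (Coeff M) (Hecke b) a) =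
        G * (gen b i + algebraMap (Coeff M) (Hecke b) a') + (a - a') • G :=
      mul_add_algebraMap_eq _ _ _ _
    rw [hv, form_mul_gen_add, hsplit, form_add_right, form_smul_right, ih', hdiff, add_zero]
    by_cases hw : b.IsPos (w • (i : ι))
    · obtain ⟨c, hc⟩ := exists_coeffAct_ybElt_mul_eq_smul h₀ hw
      -- `i` is a descent of `v` but an ascent of `w`, so the pairing vanishes whatever `c` is.
      have hvw : v ≠ w := fun h ↦ hi (h ▸ hw)
      rw [hc, form_smul_right, ih', if_neg (by rwa [hiff]), if_neg hvw, mul_zero]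
    · rw [coeffAct_ybElt_mul_simple h₀ hw, ih']
      simp only [hiff]

end Form

end YangBaxter

theorem proposition4 {ι M N : Type*} [Finite ι]
    [AddCommGroup M] [Module.Free ℤ M] [Module.Finite ℤ M]
    [AddCommGroup N]
    (P : RootPairing ι ℤ M N) [P.IsReduced] (b : P.Base)
    [DecidableEq P.weylGroup]
    (hss : b.support.card = Module.finrank ℤ M) :
    -- `h_w` is given by every reduced expression of `w`
    (∀ l : List b.support, YangBaxter.IsReducedWord b l →
      YangBaxter.heckeElt b (YangBaxter.wordProd b l) = (l.map (YangBaxter.gen b)).prod) ∧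
    -- `Y_e = 1`, and `Y_{w s_i} = Y_w (h_i + (t₁ + t₂) / w E(α_i))` whenever `w s_i > w`
    YangBaxter.ybElt b 1 = 1 ∧
    (∀ (w : P.weylGroup) (i : b.support),
      YangBaxter.length b w < YangBaxter.length b (w * YangBaxter.simple b i) →
      YangBaxter.ybElt b (w * YangBaxter.simple b i) =
        YangBaxter.ybElt b w * (YangBaxter.gen b i +
          algebraMap (YangBaxter.Coeff M) (YangBaxter.Hecke b)
            (YangBaxter.ybCoeff (w • P.root i)))) ∧
    -- there is a unique longest element
    (∃! w₀ : P.weylGroup, YangBaxter.IsLongest b w₀) ∧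
    -- the `h_w` form a basis, and the orthogonality relations hold
    ∃ B : Module.Basis P.weylGroup (YangBaxter.Coeff M) (YangBaxter.Hecke b),
      (∀ w, B w = YangBaxter.heckeElt b w) ∧
      ∀ w₀ : P.weylGroup, YangBaxter.IsLongest b w₀ → ∀ v w : P.weylGroup,
        YangBaxter.form B w₀ (YangBaxter.ybElt b v)
            (YangBaxter.coeffAct B w₀ (YangBaxter.ybElt b (w₀ * w))) =
          if v = w then 1 else 0 :=
  ⟨fun _ hl ↦ YangBaxter.heckeElt_wordProd b hl, YangBaxter.ybElt_one b,
    fun w i h ↦ YangBaxter.ybElt_mul_simple b ((YangBaxter.length_lt_mul_simple_iff b w i).1 h),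
    YangBaxter.existsUnique_isLongest b, YangBaxter.heckeBasis b,
    YangBaxter.heckeBasis_apply b, fun _ h₀ v w ↦ YangBaxter.form_ybElt_coeffAct_ybElt h₀ v w⟩
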